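/- Let $\alpha,\beta\in(0,1)$ with $\alpha+\beta<1$, and let $\Lambda=\{\lambda_k\}_{k\ge1}$ be a nondecreasing sequence of positive numbers such that the sequence $\lambda_k/k^{1-(\alpha+\beta)}$ is nonincreasing and tends to $0$, and $$\sum_{k=1}^\infty \frac{\lambda_k}{k^{2-(\alpha+\beta)}}=\infty .$$ Let $P\Lambda BV$ be the class of functions $f:\mathbb R^2\to\mathbb R$, $2\pi$-periodic in each variable, with $$\sup_{y\in[0,2\pi]}\sup_{\{I_i\}}\sum_i\frac{|f(b_i,y)-f(a_i,y)|}{\lambda_i}+\sup_{x\in[0,2\pi]}\sup_{\{I_i\}}\sum_i\frac{|f(x,b_i)-f(x,a_i)|}{\lambda_i}<\infty ,$$ where $\{I_i\}=\{(a_i,b_i)\}_{i=1,2,\dots}$ runs over all collections of nonoverlapping intervals in $[0,2\pi]$, numbered in arbitrary order. For such $f$, integrable on $[0,2\pi]^2$, put $$\widehat f(m,n)=\frac1{4\pi^2}\int_0^{2\pi}\!\!\int_0^{2\pi} f(x,y)e^{-imx}e^{-iny}\,dx\,dy,\qquad S_{M,N}[f,(x,y)]=\sum_{m=-M}^{M}\sum_{n=-N}^{N}\widehat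 f(m,n)e^{imx}e^{iny},$$ and for $a,b>-1$ let the Ces\`aro $(C;a,b)$ means be $$\sigma^{a,b}_{n,m}f(x,y)=\frac1{A_n^{a}A_m^{b}}\sum_{i=0}^n\sum_{j=0}^m A_{n-i}^{a-1}A_{m-j}^{b-1}S_{i,j}[f,(x,y)],\qquad A_0^{a}=1,\quad A_k^{a}=\frac{(a+1)\cdots(a+k)}{k!}.$$ Then there exists a continuous function $f\in P\Lambda BV$ whose $(C;-\alpha,-\beta)$ means diverge over cubes at $(0,0)$, and even $$\sup_{N}\bigl|\sigma^{-\alpha,-\beta}_{N,N}f(0,0)\bigr|=\infty ;$$ that is, the sequence $\sigma^{-\alpha,-\beta}_{N,N}f(0,0)$ is unbounded and, in particular, has no limit as $N\to\infty$. -/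

import Mathlib

open scoped ENNReal

noncomputable section

namespace DoubleFourier

/-- A finite collection of nonoverlapping intervals `(left i, right i)` of `[0, 2π]`, listed in an
arbitrary order. (An infinite sequence of such intervals contributes the supremum of the
contributions of its finite initial segments, so finite collections give the same suprema.) -/
structure IntervalFamily where
  card : ℕ
  left : Fin card → ℝ
  right : Fin card → ℝ
  left_nonneg : ∀ i, 0 ≤ left i
  left_lt_right : ∀ i, left i < right i
  right_le : ∀ i, right i ≤ 2 * Real.pi
  nonoverlapping : ∀ i j, i ≠ j →
    Disjoint (Set.Ioo (left i) (right i)) (Set.Ioo (left j) (right j))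

/-- `∑ᵢ |g(Iᵢ)| / λᵢ` for `E = {Iᵢ}`, where `g((a, b)) = g b - g a` and numbering starts at `1`. -/
def IntervalFamily.weightedSum (E : IntervalFamily) (lam : ℕ → ℝ) (g : ℝ → ℝ) : ℝ :=
  ∑ i : Fin E.card, |g (E.right i) - g (E.left i)| / lam (i.val + 1)

/-- The partial `Λ`-variation in the first variable. -/
def lambdaVar₁ (lam : ℕ → ℝ) (f : ℝ → ℝ → ℝ) : ℝ≥0∞ :=
  ⨆ y ∈ Set.Icc 0 (2 * Real.pi), ⨆ E : IntervalFamily,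
    ENNReal.ofReal (E.weightedSum lam (fun x => f x y))

/-- The partial `Λ`-variation in the second variable. -/
def lambdaVar₂ (lam : ℕ → ℝ) (f : ℝ → ℝ → ℝ) : ℝ≥0∞ :=
  ⨆ x ∈ Set.Icc 0 (2 * Real.pi), ⨆ F : IntervalFamily,
    ENNReal.ofReal (F.weightedSum lam (fun y => f x y))

/-- The class `PΛBV`: functions of period `2π` in each variable of bounded partial
`Λ`-variation. -/
structure IsPLambdaBV (lam : ℕ → ℝ) (f : ℝ → ℝ → ℝ) : Prop where
  periodic₁ : ∀ x y, f (x + 2 * Real.pi) y = f x y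
  periodic₂ : ∀ x y, f x (y + 2 * Real.pi) = f x y
  variation_lt_top : lambdaVar₁ lam f + lambdaVar₂ lam f < ⊤

/-- The Fourier coefficient `(1 / 4π²) ∫₀^{2π} ∫₀^{2π} f(x,y) e^{-imx} e^{-iny} dx dy`. -/
def fourierCoeff₂ (f : ℝ → ℝ → ℝ) (m n : ℤ) : ℂ :=
  1 / (4 * (Real.pi : ℂ) ^ 2) *
    ∫ y in (0 : ℝ)..(2 * Real.pi), ∫ x in (0 : ℝ)..(2 * Real.pi),
      (f x y : ℂ) * Complex.exp (-(Complex.I * m * x)) * Complex.exp (-(Complex.I * n * y))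

/-- The rectangular partial sum `S_{M,N}[f, (x, y)]`. -/
def partialSum (f : ℝ → ℝ → ℝ) (M N : ℕ) (x y : ℝ) : ℂ :=
  ∑ m ∈ Finset.Icc (-(M : ℤ)) (M : ℤ), ∑ n ∈ Finset.Icc (-(N : ℤ)) (N : ℤ),
    fourierCoeff₂ f m n * Complex.exp (Complex.I * m * x) * Complex.exp (Complex.I * n * y)

/-- `A_k^α = (α + 1) ⋯ (α + k) / k!`, with `A_0^α = 1`. -/
def cesaroNumber (α : ℝ) (k : ℕ) : ℝ :=
  (∏ i ∈ Finset.Icc 1 k, (α + (i : ℝ))) / (k.factorial : ℝ)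

/-- The Cesàro `(C; α, β)` mean `σ_{n,m}^{α,β} f(x, y)`. -/
def cesaroMean (α β : ℝ) (f : ℝ → ℝ → ℝ) (n m : ℕ) (x y : ℝ) : ℂ :=
  (1 / (cesaroNumber α n : ℂ)) * (1 / (cesaroNumber β m : ℂ)) *
    ∑ i ∈ Finset.range (n + 1), ∑ j ∈ Finset.range (m + 1),
      (cesaroNumber (α - 1) (n - i) : ℂ) * (cesaroNumber (β - 1) (m - j) : ℂ) *
        partialSum f i j x y

end DoubleFourier

end

noncomputable section

namespace DoubleFourier

open Filter Topology

/-! ### Cesàro numbers -/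

/-! At the origin the `(C; -α, -β)` mean is the integral of `f` against a product of two
one-dimensional kernels, divided by `4π²`. The kernel of order `-α` behaves like `n ^ α * t ^ (α -
1)` times a sine of frequency about `n`, with error `O(1 / (n t ^ 2))` (`abs_cesaroKernel_sub_le`).
Hence a wave made of `M` half-periods of that sine, on `t` between about `Mπ/n` and `2Mπ/n`, has
integral at least `M ^ α / 4` against it (`integral_wave_mul_cesaroKernel_ge`).

Such a wave has `Λ`-variation of order at most `M / λ_M`, because `λ_k / k ^ (1 - (α + β))` does not
increase. Tensor products of waves with `M = 2 ^ k`, weighted by `λ_M / M`, are added into one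
block. The dyadic ranges do not overlap, so each line parallel to an axis meets at most one wave,
and the partial variations of all blocks share one bound (`weightedSum_blockSum_le`). The kernel
integrals of the terms do add up: they give a multiple of `∑ 2 ^ k * a (2 ^ k)` with `a k = λ_k / k
^ (2 - (α + β))`, which is unbounded by Cauchy condensation (`exists_lt_kernelIntegral_blockSum`).

Finally, `ℓ¹`-superpositions of the blocks stay continuous and in the class, and the uniform
boundedness principle on `ℓ¹` yields one superposition with unbounded means
(`exists_superposition_unbounded`). -/

@[simp] lemma cesaroNumber_zero (a : ℝ) : cesaroNumber a 0 = 1 := by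
  simp [cesaroNumber]

lemma cesaroNumber_succ (a : ℝ) (k : ℕ) :
    cesaroNumber a (k + 1) = cesaroNumber a k * ((a + (k + 1)) / (k + 1)) := by
  unfold cesaroNumber
  rw [Finset.prod_Icc_succ_top (by omega), Nat.factorial_succ]
  push_cast
  have : (k.factorial : ℝ) ≠ 0 := by positivity
  field_simp

lemma sum_range_cesaroNumber (a : ℝ) (n : ℕ) :
    ∑ k ∈ Finset.range (n + 1), cesaroNumber (a - 1) k = cesaroNumber a n := by
  have key : ∀ n : ℕ, (n + 1) * cesaroNumber (a - 1) (n + 1) = a * cesaroNumber a n := by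
    intro n
    induction n with
    | zero => simp [cesaroNumber_succ]
    | succ n ih =>
      rw [cesaroNumber_succ, cesaroNumber_succ a]
      have h : cesaroNumber (a - 1) (n + 1) = a * cesaroNumber a n / (n + 1) := by
        rw [← ih]; field_simp
      rw [h]
      push_cast
      field_simp
      ring
  induction n with
  | zero => simp
  | succ n ih =>
    have h : cesaroNumber (a - 1) (n + 1) = a * cesaroNumber a n / (n + 1) := by
      rw [← key]; field_simp
    rw [Finset.sum_range_succ, ih, h, cesaroNumber_succ a]
    field_simp
    ring

lemma cesaroNumber_neg_pos {α : ℝ} (hα : α < 1) (n : ℕ) : 0 < cesaroNumber (-α) n := by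
  induction n with
  | zero => simp
  | succ n ih =>
    rw [cesaroNumber_succ]
    have : (0 : ℝ) ≤ n := n.cast_nonneg
    exact mul_pos ih (div_pos (by linarith) (by positivity))

lemma cesaroNumber_neg_antitone {α : ℝ} (h0 : 0 ≤ α) (hα : α < 1) :
    Antitone (cesaroNumber (-α)) := by
  refine antitone_nat_of_succ_le fun n => ?_
  rw [cesaroNumber_succ]
  refine mul_le_of_le_one_right (cesaroNumber_neg_pos hα n).le ?_
  rw [div_le_one (by positivity)]
  linarith

/-- Induction with Bernoulli's inequality for the exponent `α ≤ 1`. Inverted, it gives the factor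
`(n + 1) ^ α` in the size of the kernel. -/
lemma cesaroNumber_neg_le_rpow {α : ℝ} (h0 : 0 ≤ α) (hα : α < 1) (n : ℕ) :
    cesaroNumber (-α) n ≤ ((n : ℝ) + 1) ^ (-α) := by
  induction n with
  | zero => simp
  | succ n ih =>
    rw [cesaroNumber_succ]
    have hn : (0 : ℝ) < (n : ℝ) + 1 := by positivity
    have hle : ((n : ℝ) + 1 + 1) ^ α ≤ ((n : ℝ) + 1) ^ α * (1 + α / (n + 1)) := by
      have h1 : (n : ℝ) + 1 + 1 = (n + 1) * (1 + 1 / ((n : ℝ) + 1)) := by field_simp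
      rw [h1, Real.mul_rpow hn.le (by positivity)]
      gcongr
      have := rpow_one_add_le_one_add_mul_self (s := 1 / ((n : ℝ) + 1))
        (by have : 0 < 1 / ((n : ℝ) + 1) := by positivity
            linarith) h0 hα.le
      calc _ ≤ _ := this
        _ = _ := by ring
    have hq : 0 ≤ (-α + (n + 1)) / ((n : ℝ) + 1) :=
      div_nonneg (by have : (0 : ℝ) ≤ n := n.cast_nonneg
                     linarith) hn.le
    have ha : 0 < ((n : ℝ) + 1) ^ α := by positivity
    have hb : 0 < ((n : ℝ) + 1 + 1) ^ α := by positivity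
    calc _ ≤ ((n : ℝ) + 1) ^ (-α) * ((-α + (n + 1)) / ((n : ℝ) + 1)) := by gcongr
      _ ≤ _ := by
        push_cast
        rw [Real.rpow_neg hn.le, Real.rpow_neg (by positivity), ← one_div, ← one_div,
          div_mul_eq_mul_div, one_mul, div_le_div_iff₀ ha hb]
        calc _ ≤ (-α + (n + 1)) / ((n : ℝ) + 1) * (((n : ℝ) + 1) ^ α * (1 + α / (n + 1))) := by
              gcongr
          _ = ((n : ℝ) + 1) ^ α * (1 - (α / (n + 1)) ^ 2) := by field_simp; ring
          _ ≤ _ := by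
              rw [one_mul]
              exact mul_le_of_le_one_right ha.le (by linarith [sq_nonneg (α / ((n : ℝ) + 1))])

lemma cesaroNumber_neg_sub_one_succ (α : ℝ) (n : ℕ) :
    cesaroNumber (-α - 1) (n + 1) = -(α * cesaroNumber (-α) n / (n + 1)) := by
  have h := sum_range_cesaroNumber (-α) (n + 1)
  rw [Finset.sum_range_succ, sum_range_cesaroNumber, cesaroNumber_succ (-α)] at h
  have : cesaroNumber (-α - 1) (n + 1)
    = cesaroNumber (-α) n * ((-α + (n + 1)) / (n + 1)) - cesaroNumber (-α) n := by linarith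
  rw [this]
  field_simp
  ring

lemma cesaroNumber_neg_sub_one_eq_choose (α : ℝ) (n : ℕ) :
    cesaroNumber (-α - 1) n = (-1) ^ n * Ring.choose α n := by
  have h : ∏ i ∈ Finset.Icc 1 n, (-α - 1 + (i : ℝ))
      = (-1) ^ n * (descPochhammer ℤ n).smeval α := by
    induction n with
    | zero => simp
    | succ n ih =>
      rw [Finset.prod_Icc_succ_top (by omega), ih, descPochhammer_succ_right,
        Polynomial.smeval_mul]
      simp [Polynomial.smeval_natCast]
      ring
  rw [cesaroNumber, h, Ring.descPochhammer_eq_factorial_smul_choose]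
  have : (n.factorial : ℝ) ≠ 0 := by positivity
  simp
  field_simp

/-- All terms after the zeroth are nonpositive, and the partial sums `A_n^{-α}` are positive, so the
absolute values of those terms sum to at most the zeroth term, `1`. -/
lemma summable_cesaroNumber_neg_sub_one {α : ℝ} (h0 : 0 ≤ α) (hα : α < 1) :
    Summable (cesaroNumber (-α - 1)) := by
  rw [← summable_nat_add_iff 1, ← summable_neg_iff]
  refine summable_of_sum_range_le (c := 1) (fun n => ?_) (fun n => ?_)
  · rw [cesaroNumber_neg_sub_one_succ, neg_neg]
    have := cesaroNumber_neg_pos hα n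
    positivity
  · have h := sum_range_cesaroNumber (-α) n
    rw [Finset.sum_range_succ'] at h
    have := cesaroNumber_neg_pos hα n
    simp only [Finset.sum_neg_distrib]
    simp at h
    linarith

/-! ### Binomial series on the unit circle and its remainder -/

lemma one_sub_mem_slitPlane {z : ℂ} (hz : ‖z‖ ≤ 1) (h1 : z ≠ 1) : 1 - z ∈ Complex.slitPlane := by
  left
  rw [Complex.sub_re, Complex.one_re, sub_pos]
  refine lt_of_le_of_ne ((Complex.re_le_norm z).trans hz) fun h => h1 ?_
  have h2 := Complex.sq_norm z
  rw [Complex.normSq_apply, h] at h2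
  have : ‖z‖ ^ 2 ≤ 1 := pow_le_one₀ (norm_nonneg _) hz
  apply Complex.ext
  · simpa using h
  · have : z.im * z.im = 0 := by nlinarith [mul_self_nonneg z.im]
    simpa using this

lemma hasSum_cesaroNumber_of_norm_lt_one (α : ℝ) {z : ℂ} (hz : ‖z‖ < 1) :
    HasSum (fun k => (cesaroNumber (-α - 1) k : ℂ) * z ^ k) ((1 - z) ^ (α : ℂ)) := by
  have h := (Complex.one_add_cpow_hasFPowerSeriesOnBall_zero (a := (α : ℂ))).hasSum (y := -z)
    (by rw [← ENNReal.ofReal_one, Metric.eball_ofReal]; simpa using hz)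
  simp only [zero_add, binomialSeries_apply, List.ofFn_const, List.prod_replicate,
    smul_eq_mul] at h
  rw [← sub_eq_add_neg] at h
  convert! h using 2 with k
  rw [cesaroNumber_neg_sub_one_eq_choose, neg_pow z]
  push_cast
  ring

/-- Abel's limit theorem: the identity inside the disc passes to the boundary radially, since `1 -
z` stays in the slit plane where the power is continuous. -/
lemma tsum_cesaroNumber {α : ℝ} (h0 : 0 ≤ α) (hα : α < 1) {z : ℂ} (hz : ‖z‖ = 1) (h1 : z ≠ 1) :
    ∑' k, (cesaroNumber (-α - 1) k : ℂ) * z ^ k = (1 - z) ^ (α : ℂ) := by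
  have hs : Summable fun k => (cesaroNumber (-α - 1) k : ℂ) * z ^ k := by
    refine Summable.of_norm ?_
    simpa [hz] using (summable_cesaroNumber_neg_sub_one h0 hα).abs
  have hl := Complex.tendsto_tsum_powerSeries_nhdsWithin_lt hs.hasSum.tendsto_sum_nat
  rw [tendsto_map'_iff] at hl
  have hc : Tendsto (fun x : ℝ => (1 - (x : ℂ) * z) ^ (α : ℂ)) (𝓝[<] 1)
      (𝓝 ((1 - z) ^ (α : ℂ))) := by
    have : ContinuousAt (fun x : ℝ => (1 - (x : ℂ) * z) ^ (α : ℂ)) 1 := by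
      refine ContinuousAt.cpow (by fun_prop) continuousAt_const ?_
      simpa using one_sub_mem_slitPlane hz.le h1
    simpa [ContinuousAt] using this.tendsto.mono_left nhdsWithin_le_nhds
  refine tendsto_nhds_unique (hl.congr' ?_) hc
  have hpos : ∀ᶠ x : ℝ in 𝓝[<] 1, 0 < x := nhdsWithin_le_nhds (lt_mem_nhds one_pos)
  filter_upwards [self_mem_nhdsWithin, hpos] with x hx hx0
  have := hasSum_cesaroNumber_of_norm_lt_one α (z := x * z)
    (by simpa [hz, abs_of_pos hx0] using hx)
  rw [← this.tsum_eq]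
  refine tsum_congr fun k => ?_
  simp [mul_pow]
  ring

/-- Summation by parts: the product is `b 0` minus a series with coefficients `b k - b (k + 1) ≥ 0`,
whose sum telescopes to `b 0`. -/
lemma norm_one_sub_mul_tsum_le {b : ℕ → ℝ} (hb : Antitone b) (hnn : ∀ k, 0 ≤ b k)
    (hs : Summable b) {z : ℂ} (hz : ‖z‖ = 1) :
    ‖(1 - z) * ∑' k, (b k : ℂ) * z ^ k‖ ≤ 2 * b 0 := by
  have hs1 : Summable fun k => (b k : ℂ) * z ^ k := by
    refine Summable.of_norm ?_
    simpa [hz] using hs.abs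
  have hs2 := (summable_nat_add_iff 1).2 hs1
  have hd : HasSum (fun k => b k - b (k + 1)) (b 0) := by
    have := hs.hasSum.sub ((summable_nat_add_iff 1).2 hs).hasSum
    rw [hs.tsum_eq_zero_add] at this
    simpa using this
  have e : (1 - z) * ∑' k, (b k : ℂ) * z ^ k
      = b 0 - ∑' k, ((b k : ℂ) - b (k + 1)) * z ^ (k + 1) := by
    have e1 : ∑' k, ((b k : ℂ) - b (k + 1)) * z ^ (k + 1)
        = z * ∑' k, (b k : ℂ) * z ^ k - ∑' k, (b (k + 1) : ℂ) * z ^ (k + 1) := by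
      rw [← tsum_mul_left, ← (hs1.mul_left z).tsum_sub hs2]
      refine tsum_congr fun k => ?_
      ring
    rw [e1]
    have e2 := hs1.tsum_eq_zero_add
    simp only [pow_zero, mul_one] at e2
    have e3 : ∑' k, (b (k + 1) : ℂ) * z ^ (k + 1) = ∑' k, (b k : ℂ) * z ^ k - b 0 := by
      rw [e2]; ring
    rw [e3]
    ring
  rw [e]
  have hn : ‖∑' k, ((b k : ℂ) - b (k + 1)) * z ^ (k + 1)‖ ≤ b 0 := by
    refine tsum_of_norm_bounded hd fun k => ?_
    rw [norm_mul, norm_pow, hz, one_pow, mul_one, ← Complex.ofReal_sub, Complex.norm_real,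
      Real.norm_of_nonneg (sub_nonneg.2 (hb k.le_succ))]
  calc _ ≤ ‖(b 0 : ℂ)‖ + b 0 := (norm_sub_le _ _).trans (by gcongr)
    _ = 2 * b 0 := by rw [Complex.norm_real, Real.norm_of_nonneg (hnn 0)]; ring

/-- The tail coefficients, with sign reversed, are nonnegative and decreasing, so
`norm_one_sub_mul_tsum_le` applies after factoring out `z ^ (n + 1)`; the right side is twice the
first of them. -/
lemma norm_cpow_sub_sum_cesaroNumber_le {α : ℝ} (h0 : 0 ≤ α) (hα : α < 1) {z : ℂ}
    (hz : ‖z‖ = 1) (h1 : z ≠ 1) (n : ℕ) :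
    ‖1 - z‖ * ‖(1 - z) ^ (α : ℂ) -
        ∑ k ∈ Finset.range (n + 1), (cesaroNumber (-α - 1) k : ℂ) * z ^ k‖
      ≤ 2 * (α * cesaroNumber (-α) n / (n + 1)) := by
  have hs := summable_cesaroNumber_neg_sub_one h0 hα
  have hsz : Summable fun k => (cesaroNumber (-α - 1) k : ℂ) * z ^ k := by
    refine Summable.of_norm ?_
    simpa [hz] using hs.abs
  set b : ℕ → ℝ := fun k => -cesaroNumber (-α - 1) (k + (n + 1)) with hb
  have hbe : ∀ k, b k = α * cesaroNumber (-α) (k + n) / ((k + n : ℕ) + 1) := fun k => by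
    simp only [hb, ← add_assoc]
    rw [cesaroNumber_neg_sub_one_succ, neg_neg]
  have key := norm_one_sub_mul_tsum_le (b := b) (fun k l hkl => ?_) (fun k => ?_)
    ((summable_nat_add_iff (n + 1)).2 hs).neg hz
  · rw [← tsum_cesaroNumber h0 hα hz h1, ← hsz.sum_add_tsum_nat_add (n + 1), add_sub_cancel_left,
      ← norm_mul]
    have e : ∑' k, (cesaroNumber (-α - 1) (k + (n + 1)) : ℂ) * z ^ (k + (n + 1))
        = -(z ^ (n + 1) * ∑' k, (b k : ℂ) * z ^ k) := by
      rw [← tsum_mul_left, ← tsum_neg]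
      refine tsum_congr fun k => ?_
      simp only [hb]
      push_cast
      ring
    rw [e, mul_neg, norm_neg, mul_left_comm, norm_mul, norm_pow, hz, one_pow, one_mul]
    refine key.trans_eq ?_
    rw [hbe]
    simp
  · rw [hbe, hbe]
    have := cesaroNumber_neg_pos hα (k + n)
    have := cesaroNumber_neg_antitone h0 hα (Nat.add_le_add_right hkl n)
    gcongr
  · rw [hbe]
    have := cesaroNumber_neg_pos hα (k + n)
    positivity

/-! ### The Cesàro kernel -/

/-- The Dirichlet kernel `∑_{|m| ≤ i} e^{-imt}` in real form. -/
def dirichletKernel (i : ℕ) (t : ℝ) : ℝ :=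
  1 + 2 * ∑ m ∈ Finset.range i, Real.cos ((m + 1) * t)

lemma sum_exp_eq_dirichletKernel (i : ℕ) (t : ℝ) :
    ∑ m ∈ Finset.Icc (-(i : ℤ)) (i : ℤ), Complex.exp (-(Complex.I * m * t))
      = dirichletKernel i t := by
  induction i with
  | zero => simp [dirichletKernel]
  | succ i ih =>
    have hI : Finset.Icc (-((i + 1 : ℕ) : ℤ)) ((i + 1 : ℕ) : ℤ)
        = insert (-((i + 1 : ℕ) : ℤ)) (insert ((i + 1 : ℕ) : ℤ) (Finset.Icc (-(i : ℤ)) (i : ℤ))) := by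
      ext m
      simp only [Finset.mem_Icc, Finset.mem_insert]
      push_cast
      omega
    rw [hI, Finset.sum_insert, Finset.sum_insert, ih, dirichletKernel, dirichletKernel,
      Finset.sum_range_succ]
    · push_cast
      rw [Complex.cos]
      have e1 : -(Complex.I * -((i : ℂ) + 1) * t) = ((i : ℂ) + 1) * t * Complex.I := by ring
      have e2 : -(Complex.I * ((i : ℂ) + 1) * t) = -(((i : ℂ) + 1) * t) * Complex.I := by ring
      rw [e1, e2]
      ring
    · simp
    · simp only [Finset.mem_insert, Finset.mem_Icc]
      push_cast
      omega

lemma sin_half_mul_dirichletKernel (i : ℕ) (t : ℝ) :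
    Real.sin (t / 2) * dirichletKernel i t = Real.sin ((i + 1 / 2) * t) := by
  induction i with
  | zero => simp [dirichletKernel]; ring_nf
  | succ i ih =>
    have h : dirichletKernel (i + 1) t = dirichletKernel i t + 2 * Real.cos ((i + 1) * t) := by
      rw [dirichletKernel, dirichletKernel, Finset.sum_range_succ]; ring
    rw [h, mul_add, ih]
    have e1 : ((i : ℝ) + 1 / 2) * t = (i + 1) * t - t / 2 := by ring
    have e2 : (((i + 1 : ℕ) : ℝ) + 1 / 2) * t = (i + 1) * t + t / 2 := by push_cast; ring
    rw [e1, e2, Real.sin_sub, Real.sin_add]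
    ring

/-- The kernel of the one-dimensional Cesàro means of order `a`. -/
def cesaroKernel (a : ℝ) (n : ℕ) (t : ℝ) : ℝ :=
  (∑ i ∈ Finset.range (n + 1), cesaroNumber (a - 1) (n - i) * dirichletKernel i t) /
    cesaroNumber a n

@[fun_prop]
lemma continuous_dirichletKernel (i : ℕ) : Continuous (dirichletKernel i) := by
  unfold dirichletKernel
  fun_prop

@[fun_prop]
lemma continuous_cesaroKernel (a : ℝ) (n : ℕ) : Continuous (cesaroKernel a n) := by
  unfold cesaroKernel
  fun_prop

/-- The phase of the principal part of the Cesàro kernel of order `-α`. -/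
def kernelPhase (α : ℝ) (n : ℕ) (t : ℝ) : ℝ :=
  (n + (1 - α) / 2) * t + α * Real.pi / 2

lemma one_sub_exp_neg_mul_I (t : ℝ) :
    1 - Complex.exp (-(t * Complex.I))
      = ((2 * Real.sin (t / 2) : ℝ) : ℂ) * Complex.exp (((Real.pi - t) / 2 : ℝ) * Complex.I) := by
  have e1 : ((((Real.pi - t) / 2 : ℝ) : ℂ) * Complex.I)
      = (Real.pi / 2 : ℂ) * Complex.I + -((t / 2 : ℂ) * Complex.I) := by push_cast; ring
  rw [e1, Complex.exp_add, Complex.exp_pi_div_two_mul_I]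
  push_cast
  rw [Complex.sin]
  have e2 : Complex.exp (-(t * Complex.I))
    = Complex.exp (-((t / 2 : ℂ) * Complex.I)) * Complex.exp (-((t / 2 : ℂ) * Complex.I)) := by
    rw [← Complex.exp_add]; congr 1; ring
  have e3 : Complex.exp (t / 2 * Complex.I) * Complex.exp (-((t / 2 : ℂ) * Complex.I)) = 1 := by
    rw [← Complex.exp_add]; simp
  rw [e2, neg_mul]
  linear_combination (-1 : ℂ) * e3 +
    (Complex.exp (t / 2 * Complex.I) * Complex.exp (-((t / 2 : ℂ) * Complex.I)) -
      Complex.exp (-((t / 2 : ℂ) * Complex.I)) * Complex.exp (-((t / 2 : ℂ) * Complex.I))) *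
      Complex.I_sq

/-- The argument `(π - t) / 2` lies in `[0, π / 2)`, so the principal logarithm reads it off
directly. -/
lemma one_sub_exp_cpow {α t : ℝ} (h0 : 0 < t) (h1 : t ≤ Real.pi) :
    (1 - Complex.exp (-(t * Complex.I))) ^ (α : ℂ)
      = (((2 * Real.sin (t / 2)) ^ α : ℝ) : ℂ) *
        Complex.exp ((α * (Real.pi - t) / 2 : ℝ) * Complex.I) := by
  have hs : 0 < Real.sin (t / 2) :=
    Real.sin_pos_of_pos_of_lt_pi (by linarith) (by linarith [Real.pi_pos])
  have hS : 0 < 2 * Real.sin (t / 2) := by positivity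
  have e : ((2 * Real.sin (t / 2) : ℝ) : ℂ) * Complex.exp (((Real.pi - t) / 2 : ℝ) * Complex.I)
      = Complex.exp ((Real.log (2 * Real.sin (t / 2)) : ℝ) +
        ((Real.pi - t) / 2 : ℝ) * Complex.I) := by
    rw [Complex.exp_add, ← Complex.ofReal_exp, Real.exp_log hS]
  rw [one_sub_exp_neg_mul_I, e, Complex.cpow_def_of_ne_zero (Complex.exp_ne_zero _),
    Complex.log_exp, add_mul, Complex.exp_add, Real.rpow_def_of_pos hS, Complex.ofReal_exp]
  · push_cast
    congr 2
    ring
  · simp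
    linarith [Real.pi_pos]
  · simp
    linarith [Real.pi_pos]

/-- Reversing the summation by `k = n - i` turns the kernel into a partial sum of the binomial
series of `(1 - z) ^ α` at `z = e^{-it}`. -/
lemma sin_half_mul_cesaroKernel_neg {α : ℝ} (hα : α < 1) (n : ℕ) (t : ℝ) :
    Real.sin (t / 2) * cesaroKernel (-α) n t * cesaroNumber (-α) n
      = (Complex.exp (((n + 1 / 2) * t : ℝ) * Complex.I) *
        ∑ k ∈ Finset.range (n + 1), (cesaroNumber (-α - 1) k : ℂ) *
          Complex.exp (-(t * Complex.I)) ^ k).im := by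
  have hA := (cesaroNumber_neg_pos hα n).ne'
  rw [cesaroKernel, mul_assoc, div_mul_cancel₀ _ hA, Finset.mul_sum, Finset.mul_sum,
    Complex.im_sum, ← Finset.sum_range_reflect]
  refine Finset.sum_congr rfl fun k hk => ?_
  have hk' : k ≤ n := Nat.lt_succ_iff.1 (Finset.mem_range.1 hk)
  have e : n + 1 - 1 - k = n - k := by omega
  rw [e, Nat.sub_sub_self hk', mul_left_comm, sin_half_mul_dirichletKernel, ← Complex.exp_nat_mul,
    mul_left_comm, ← Complex.exp_add, Complex.im_ofReal_mul]
  congr 1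
  have e2 : ((((n : ℝ) + 1 / 2) * t : ℝ) : ℂ) * Complex.I + k * -(t * Complex.I)
      = (((((n - k : ℕ) : ℝ) + 1 / 2) * t : ℝ) : ℂ) * Complex.I := by
    push_cast [hk']
    ring
  rw [e2, Complex.exp_ofReal_mul_I_im]

/-- The Cesàro kernel of negative order is its principal part up to `O(1 / (n t ^ 2))`. -/
lemma abs_cesaroKernel_sub_le {α : ℝ} (h0 : 0 ≤ α) (hα : α < 1) (n : ℕ) {t : ℝ} (ht0 : 0 < t)
    (ht : t ≤ Real.pi) :
    |cesaroKernel (-α) n t - 2 * (2 * Real.sin (t / 2)) ^ (α - 1) * Real.sin (kernelPhase α n t) /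
        cesaroNumber (-α) n| ≤ 4 / ((n + 1) * (2 * Real.sin (t / 2)) ^ 2) := by
  have hs : 0 < Real.sin (t / 2) :=
    Real.sin_pos_of_pos_of_lt_pi (by linarith) (by linarith [Real.pi_pos])
  have hA := cesaroNumber_neg_pos hα n
  set S := 2 * Real.sin (t / 2) with hS
  have hSpos : 0 < S := by positivity
  set z := Complex.exp (-(t * Complex.I)) with hz
  have hnorm : ‖z‖ = 1 := by
    rw [hz, ← neg_mul, ← Complex.ofReal_neg, Complex.norm_exp_ofReal_mul_I]
  have hn1 : ‖1 - z‖ = S := by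
    rw [hz, one_sub_exp_neg_mul_I, norm_mul, Complex.norm_exp_ofReal_mul_I, mul_one,
      Complex.norm_real, Real.norm_of_nonneg hSpos.le]
  have hz1 : z ≠ 1 := fun h => by
    rw [h] at hn1; simp at hn1; linarith
  have key := norm_cpow_sub_sum_cesaroNumber_le h0 hα hnorm hz1 n
  rw [hn1] at key
  set P := ∑ k ∈ Finset.range (n + 1), (cesaroNumber (-α - 1) k : ℂ) * z ^ k with hP
  set E := Complex.exp (((n + 1 / 2) * t : ℝ) * Complex.I) with hE
  have hK : S * cesaroKernel (-α) n t * cesaroNumber (-α) n = 2 * (E * P).im := by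
    rw [← sin_half_mul_cesaroKernel_neg hα, hS]; ring
  have hM : S ^ α * Real.sin (kernelPhase α n t) = (E * (1 - z) ^ (α : ℂ)).im := by
    rw [hz, one_sub_exp_cpow ht0 ht, mul_left_comm, Complex.im_ofReal_mul, hE, ← Complex.exp_add,
      ← add_mul, ← Complex.ofReal_add, Complex.exp_ofReal_mul_I_im, kernelPhase]
    congr 2
    ring
  have hd : |(E * P).im - (E * (1 - z) ^ (α : ℂ)).im| ≤ ‖(1 - z) ^ (α : ℂ) - P‖ := by
    rw [← Complex.sub_im, ← mul_sub]
    refine (Complex.abs_im_le_norm _).trans ?_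
    rw [norm_mul, hE, Complex.norm_exp_ofReal_mul_I, one_mul, norm_sub_rev]
  have hSα : S ^ α = S ^ (α - 1) * S := by
    rw [Real.rpow_sub_one hSpos.ne']; field_simp
  have e : cesaroKernel (-α) n t - 2 * S ^ (α - 1) * Real.sin (kernelPhase α n t) /
      cesaroNumber (-α) n
      = 2 * ((E * P).im - (E * (1 - z) ^ (α : ℂ)).im) / (S * cesaroNumber (-α) n) := by
    rw [← hM, hSα, mul_sub, ← hK]
    field_simp
  rw [e, abs_div, abs_mul, abs_two, abs_of_pos (mul_pos hSpos hA), div_le_div_iff₀ (by positivity)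
    (by positivity)]
  have h3 : S * |(E * P).im - (E * (1 - z) ^ (α : ℂ)).im|
      ≤ 2 * (cesaroNumber (-α) n / (n + 1)) := by
    calc _ ≤ S * ‖(1 - z) ^ (α : ℂ) - P‖ := by gcongr
      _ ≤ 2 * (α * cesaroNumber (-α) n / (n + 1)) := key
      _ ≤ 2 * (1 * cesaroNumber (-α) n / (n + 1)) := by gcongr
      _ = _ := by ring
  calc 2 * |(E * P).im - (E * (1 - z) ^ (α : ℂ)).im| * ((n + 1) * S ^ 2)
      = 2 * (n + 1) * S * (S * |(E * P).im - (E * (1 - z) ^ (α : ℂ)).im|) := by ring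
    _ ≤ 2 * (n + 1) * S * (2 * (cesaroNumber (-α) n / (n + 1))) := by gcongr
    _ = _ := by field_simp; ring

/-! ### Cesàro means as integrals against the kernel -/

/-- The integral of `f(x, y) g(x) h(y)` over the square of periods. -/
def tensorIntegral (f : ℝ → ℝ → ℝ) (g h : ℝ → ℂ) : ℂ :=
  ∫ y in (0 : ℝ)..(2 * Real.pi), ∫ x in (0 : ℝ)..(2 * Real.pi), (f x y : ℂ) * g x * h y

lemma tensorIntegral_sum {f : ℝ → ℝ → ℝ} (hf : Continuous fun p : ℝ × ℝ => f p.1 p.2)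
    {ι κ : Type*} (s : Finset ι) (t : Finset κ) (c : ι → ℂ) (d : κ → ℂ) (g : ι → ℝ → ℂ)
    (h : κ → ℝ → ℂ) (hg : ∀ i, Continuous (g i)) (hh : ∀ j, Continuous (h j)) :
    tensorIntegral f (fun x => ∑ i ∈ s, c i * g i x) (fun y => ∑ j ∈ t, d j * h j y)
      = ∑ i ∈ s, ∑ j ∈ t, c i * d j * tensorIntegral f (g i) (h j) := by
  have hc : ∀ i j, Continuous fun p : ℝ × ℝ => (f p.2 p.1 : ℂ) * g i p.2 * h j p.1 := fun i j => by
    have h1 : Continuous fun p : ℝ × ℝ => f p.2 p.1 := hf.comp continuous_swap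
    have h2 := (hg i).comp (continuous_snd (X := ℝ) (Y := ℝ))
    have h3 := (hh j).comp (continuous_fst (X := ℝ) (Y := ℝ))
    exact ((Complex.continuous_ofReal.comp h1).mul h2).mul h3
  have hin : ∀ i j, Continuous fun y : ℝ =>
      ∫ x in (0 : ℝ)..(2 * Real.pi), (f x y : ℂ) * g i x * h j y := fun i j =>
    intervalIntegral.continuous_parametric_intervalIntegral_of_continuous' (hc i j) _ _
  unfold tensorIntegral
  simp_rw [← intervalIntegral.integral_const_mul]
  have e : ∀ y : ℝ, (∫ x in (0 : ℝ)..(2 * Real.pi),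
      (f x y : ℂ) * (∑ i ∈ s, c i * g i x) * ∑ j ∈ t, d j * h j y)
      = ∑ i ∈ s, ∑ j ∈ t, ∫ x in (0 : ℝ)..(2 * Real.pi),
          c i * d j * ((f x y : ℂ) * g i x * h j y) := by
    intro y
    have hx : ∀ i j, Continuous fun x : ℝ => (f x y : ℂ) * g i x * h j y := fun i j =>
      (hc i j).comp (Continuous.prodMk_right y)
    have hx' : ∀ i j, IntervalIntegrable (fun x : ℝ => c i * d j * ((f x y : ℂ) * g i x * h j y))
        MeasureTheory.volume 0 (2 * Real.pi) := fun i j =>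
      (continuous_const.mul (hx i j)).intervalIntegrable _ _
    simp_rw [← intervalIntegral.integral_finsetSum (fun j (_ : j ∈ t) => hx' _ j)]
    rw [← intervalIntegral.integral_finsetSum]
    · refine intervalIntegral.integral_congr fun x _ => ?_
      simp only [Finset.mul_sum, Finset.sum_mul]
      rw [Finset.sum_comm]
      refine Finset.sum_congr rfl fun i _ => Finset.sum_congr rfl fun j _ => ?_
      ring
    · intro i _
      exact (continuous_finsetSum _ fun j _ => continuous_const.mul (hx i j)).intervalIntegrable _ _
  simp_rw [e, intervalIntegral.integral_const_mul]
  rw [intervalIntegral.integral_finsetSum]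
  · refine Finset.sum_congr rfl fun i _ => ?_
    rw [intervalIntegral.integral_finsetSum]
    · simp_rw [intervalIntegral.integral_const_mul]
    · intro j _
      exact (continuous_const.mul (hin i j)).intervalIntegrable _ _
  · intro i _
    exact (continuous_finsetSum _ fun j _ => continuous_const.mul (hin i j)).intervalIntegrable _ _

lemma partialSum_zero_eq {f : ℝ → ℝ → ℝ} (hf : Continuous fun p : ℝ × ℝ => f p.1 p.2) (M N : ℕ) :
    partialSum f M N 0 0 = 1 / (4 * (Real.pi : ℂ) ^ 2) *
      tensorIntegral f (fun x => dirichletKernel M x) (fun y => dirichletKernel N y) := by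
  have h := tensorIntegral_sum hf (Finset.Icc (-(M : ℤ)) (M : ℤ)) (Finset.Icc (-(N : ℤ)) (N : ℤ))
    (fun _ => 1) (fun _ => 1) (fun m x => Complex.exp (-(Complex.I * m * x)))
    (fun n y => Complex.exp (-(Complex.I * n * y))) (fun m => by fun_prop) (fun n => by fun_prop)
  simp only [one_mul, sum_exp_eq_dirichletKernel] at h
  rw [h, Finset.mul_sum, partialSum]
  refine Finset.sum_congr rfl fun m _ => ?_
  rw [Finset.mul_sum]
  refine Finset.sum_congr rfl fun n _ => ?_
  simp [fourierCoeff₂, tensorIntegral]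

/-- The integral of `f` against the product of the Cesàro kernels. -/
def kernelIntegral (a b : ℝ) (n m : ℕ) (f : ℝ → ℝ → ℝ) : ℝ :=
  ∫ y in (0 : ℝ)..(2 * Real.pi), ∫ x in (0 : ℝ)..(2 * Real.pi),
    f x y * cesaroKernel a n x * cesaroKernel b m y

lemma cesaroMean_zero_eq (a b : ℝ) {f : ℝ → ℝ → ℝ}
    (hf : Continuous fun p : ℝ × ℝ => f p.1 p.2) (n m : ℕ) :
    cesaroMean a b f n m 0 0 = ((1 / (4 * Real.pi ^ 2) * kernelIntegral a b n m f : ℝ) : ℂ) := by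
  have h := tensorIntegral_sum hf (Finset.range (n + 1)) (Finset.range (m + 1))
    (fun i => (cesaroNumber (a - 1) (n - i) : ℂ) / cesaroNumber a n)
    (fun j => (cesaroNumber (b - 1) (m - j) : ℂ) / cesaroNumber b m)
    (fun i x => dirichletKernel i x) (fun j y => dirichletKernel j y)
    (fun m => by fun_prop) (fun n => by fun_prop)
  have hk : ∀ (a : ℝ) (n : ℕ) (x : ℝ), ∑ i ∈ Finset.range (n + 1),
      (cesaroNumber (a - 1) (n - i) : ℂ) / cesaroNumber a n * dirichletKernel i x
        = (cesaroKernel a n x : ℂ) := fun a n x => by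
    rw [cesaroKernel]
    push_cast
    rw [Finset.sum_div]
    refine Finset.sum_congr rfl fun i _ => ?_
    ring
  simp only [hk] at h
  have hr : ((kernelIntegral a b n m f : ℝ) : ℂ)
      = tensorIntegral f (fun x => cesaroKernel a n x) (fun y => cesaroKernel b m y) := by
    simp only [kernelIntegral, tensorIntegral, ← intervalIntegral.integral_ofReal,
      Complex.ofReal_mul]
  rw [Complex.ofReal_mul, hr, h, cesaroMean, Finset.mul_sum, Finset.mul_sum]
  refine Finset.sum_congr rfl fun i _ => ?_
  rw [Finset.mul_sum, Finset.mul_sum]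
  refine Finset.sum_congr rfl fun j _ => ?_
  rw [partialSum_zero_eq hf]
  push_cast
  ring

lemma kernelIntegral_add_smul (a b : ℝ) (n m : ℕ) {f g : ℝ → ℝ → ℝ}
    (hf : Continuous fun p : ℝ × ℝ => f p.1 p.2) (hg : Continuous fun p : ℝ × ℝ => g p.1 p.2)
    (c : ℝ) :
    kernelIntegral a b n m (fun x y => f x y + c * g x y)
      = kernelIntegral a b n m f + c * kernelIntegral a b n m g := by
  have hc : ∀ {f : ℝ → ℝ → ℝ}, (Continuous fun p : ℝ × ℝ => f p.1 p.2) →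
      Continuous fun p : ℝ × ℝ => f p.2 p.1 * cesaroKernel a n p.2 * cesaroKernel b m p.1 :=
    fun {f} hf => by
      have h1 : Continuous fun p : ℝ × ℝ => f p.2 p.1 := hf.comp continuous_swap
      fun_prop
  have hin : ∀ {f : ℝ → ℝ → ℝ}, (Continuous fun p : ℝ × ℝ => f p.1 p.2) → Continuous fun y : ℝ =>
      ∫ x in (0 : ℝ)..(2 * Real.pi), f x y * cesaroKernel a n x * cesaroKernel b m y := fun hf =>
    intervalIntegral.continuous_parametric_intervalIntegral_of_continuous' (hc hf) _ _
  have hx : ∀ {f : ℝ → ℝ → ℝ}, (Continuous fun p : ℝ × ℝ => f p.1 p.2) → ∀ y : ℝ,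
      Continuous fun x : ℝ => f x y * cesaroKernel a n x * cesaroKernel b m y := fun hf y =>
    (hc hf).comp (Continuous.prodMk_right y)
  unfold kernelIntegral
  rw [← intervalIntegral.integral_const_mul, ← intervalIntegral.integral_add
    ((hin hf).intervalIntegrable _ _) (((hin hg).intervalIntegrable _ _).const_mul c)]
  refine intervalIntegral.integral_congr fun y _ => ?_
  simp only
  rw [← intervalIntegral.integral_const_mul, ← intervalIntegral.integral_add
    ((hx hf y).intervalIntegrable _ _)
    (((hx hg y).intervalIntegrable _ _).const_mul c)]
  refine intervalIntegral.integral_congr fun x _ => ?_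
  ring

lemma kernelIntegral_mul (a b : ℝ) (n m : ℕ) (u v : ℝ → ℝ) :
    kernelIntegral a b n m (fun x y => u x * v y)
      = (∫ x in (0 : ℝ)..(2 * Real.pi), u x * cesaroKernel a n x) *
        ∫ y in (0 : ℝ)..(2 * Real.pi), v y * cesaroKernel b m y := by
  unfold kernelIntegral
  rw [← intervalIntegral.integral_const_mul]
  refine intervalIntegral.integral_congr fun y _ => ?_
  simp only
  rw [← intervalIntegral.integral_mul_const]
  refine intervalIntegral.integral_congr fun x _ => ?_
  ring

lemma kernelIntegral_sum (a b : ℝ) (n m : ℕ) {ι : Type*} (s : Finset ι) (c : ι → ℝ)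
    (u v : ι → ℝ → ℝ) (hu : ∀ i, Continuous (u i)) (hv : ∀ i, Continuous (v i)) :
    kernelIntegral a b n m (fun x y => ∑ i ∈ s, c i * (u i x * v i y))
      = ∑ i ∈ s, c i * kernelIntegral a b n m (fun x y => u i x * v i y) := by
  classical
  have hc : ∀ i, Continuous fun p : ℝ × ℝ => u i p.1 * v i p.2 := fun i => by fun_prop
  induction s using Finset.induction_on with
  | empty => simp [kernelIntegral]
  | insert i s hi ih =>
    simp only [Finset.sum_insert hi]
    rw [← ih, add_comm, ← kernelIntegral_add_smul a b n m
      (continuous_finsetSum _ fun i _ => continuous_const.mul (hc i)) (hc i)]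
    simp only [add_comm]

/-- The constant may depend on `n` and `m`: it serves only to make each functional in the
Banach–Steinhaus argument continuous. -/
lemma exists_abs_kernelIntegral_le (a b : ℝ) (n m : ℕ) :
    ∃ C : ℝ, 0 ≤ C ∧ ∀ (f : ℝ → ℝ → ℝ) (B : ℝ), (∀ x y, |f x y| ≤ B) →
      |kernelIntegral a b n m f| ≤ C * B := by
  have hbd : ∀ (a : ℝ) (n : ℕ), ∃ C, 0 ≤ C ∧
      ∀ x ∈ Set.uIoc 0 (2 * Real.pi), |cesaroKernel a n x| ≤ C :=
    fun a n => by
      obtain ⟨C, hC⟩ := (isCompact_uIcc (a := 0) (b := 2 * Real.pi)).exists_bound_of_continuousOn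
        (continuous_cesaroKernel a n).continuousOn
      exact ⟨max C 0, le_max_right _ _,
        fun x hx => (hC x (Set.uIoc_subset_uIcc hx)).trans (le_max_left _ _)⟩
  obtain ⟨C, hC0, hC⟩ := hbd a n
  obtain ⟨D, hD0, hD⟩ := hbd b m
  refine ⟨C * D * |2 * Real.pi - 0| * |2 * Real.pi - 0|, by positivity, fun f B hB => ?_⟩
  have hB0 : 0 ≤ B := (abs_nonneg _).trans (hB 0 0)
  have h := intervalIntegral.norm_integral_le_of_norm_le_const (a := 0) (b := 2 * Real.pi)
    (f := fun y => ∫ x in (0 : ℝ)..(2 * Real.pi), f x y * cesaroKernel a n x * cesaroKernel b m y)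
    (C := B * C * D * |2 * Real.pi - 0|) fun y hy =>
      intervalIntegral.norm_integral_le_of_norm_le_const fun x hx => by
        rw [Real.norm_eq_abs, abs_mul, abs_mul]
        have := hB x y
        have := hC x hx
        have := hD y hy
        gcongr
  refine h.trans_eq ?_
  ring

/-! ### Weighted variation -/

/-- The increments are the Stieltjes measures of disjoint subintervals of `[0, 2π]`; continuity of
`φ` removes the endpoint masses. -/
lemma IntervalFamily.sum_increments_le (E : IntervalFamily) {φ : ℝ → ℝ} (hφ : Monotone φ)
    (hc : Continuous φ) :
    ∑ i, (φ (E.right i) - φ (E.left i)) ≤ φ (2 * Real.pi) - φ 0 := by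
  let F : StieltjesFunction ℝ := ⟨φ, hφ, fun x => hc.continuousWithinAt⟩
  have hF : ∀ x, F x = φ x := fun x => rfl
  have hFc : Continuous (F : ℝ → ℝ) := hc
  have hl : ∀ x, Function.leftLim (F : ℝ → ℝ) x = φ x := fun x =>
    ContinuousWithinAt.leftLim_eq hFc.continuousWithinAt
  have h1 : F.measure (⋃ i ∈ Finset.univ, Set.Ioo (E.left i) (E.right i))
      ≤ F.measure (Set.Icc 0 (2 * Real.pi)) := by
    refine MeasureTheory.measure_mono (Set.iUnion₂_subset fun i _ x hx => ?_)
    exact ⟨(E.left_nonneg i).trans hx.1.le, hx.2.le.trans (E.right_le i)⟩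
  rw [MeasureTheory.measure_biUnion_finset (fun i _ j _ hij => E.nonoverlapping i j hij)
    (fun i _ => measurableSet_Ioo), StieltjesFunction.measure_Icc, hl] at h1
  simp only [StieltjesFunction.measure_Ioo, hl] at h1
  simp only [hF] at h1
  rw [← ENNReal.ofReal_sum_of_nonneg
    (fun i _ => sub_nonneg.2 (hφ (E.left_lt_right i).le))] at h1
  exact (ENNReal.ofReal_le_ofReal_iff (sub_nonneg.2 (hφ (by positivity)))).1 h1

lemma le_of_succ_le {lam : ℕ → ℝ} (hmono : ∀ k : ℕ, 1 ≤ k → lam k ≤ lam (k + 1)) {k l : ℕ}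
    (hk : 1 ≤ k) (hkl : k ≤ l) : lam k ≤ lam l := by
  induction l, hkl using Nat.le_induction with
  | base => exact le_rfl
  | succ l hl ih => exact ih.trans (hmono l (hk.trans hl))

/-- The first `M` intervals are charged the trivial oscillation `2`; for the later ones the weight
is at most `1 / λ_M` and the increments of `φ` are summed. -/
lemma IntervalFamily.weightedSum_le (E : IntervalFamily) {lam : ℕ → ℝ}
    (hpos : ∀ k : ℕ, 1 ≤ k → 0 < lam k) (hmono : ∀ k : ℕ, 1 ≤ k → lam k ≤ lam (k + 1))
    {g φ : ℝ → ℝ} (hg : ∀ x, |g x| ≤ 1) (hφ : Monotone φ) (hc : Continuous φ)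
    (hgφ : ∀ x ∈ Set.Icc 0 (2 * Real.pi), ∀ y ∈ Set.Icc 0 (2 * Real.pi), x ≤ y →
      |g y - g x| ≤ φ y - φ x) {M : ℕ} (hM : 1 ≤ M) :
    E.weightedSum lam g
      ≤ 2 * ∑ k ∈ Finset.range M, 1 / lam (k + 1) + (φ (2 * Real.pi) - φ 0) / lam M := by
  have hterm : ∀ i : Fin E.card, |g (E.right i) - g (E.left i)| / lam (i.val + 1)
      ≤ (if i.val < M then 2 / lam (i.val + 1) else 0)
        + (φ (E.right i) - φ (E.left i)) / lam M := by
    intro i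
    have hi := hpos (i.val + 1) (by omega)
    have hMp := hpos M hM
    have hinc := sub_nonneg.2 (hφ (E.left_lt_right i).le)
    have hlr := (E.left_lt_right i).le
    split_ifs with h
    · have : |g (E.right i) - g (E.left i)| ≤ 2 := by
        have h1 := hg (E.right i)
        have h2 := hg (E.left i)
        calc _ ≤ |g (E.right i)| + |g (E.left i)| := abs_sub _ _
          _ ≤ 2 := by linarith
      have h3 : |g (E.right i) - g (E.left i)| / lam (i.val + 1) ≤ 2 / lam (i.val + 1) := by gcongr
      have h4 : 0 ≤ (φ (E.right i) - φ (E.left i)) / lam M := by positivity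
      linarith
    · rw [zero_add]
      have hl : lam M ≤ lam (i.val + 1) := le_of_succ_le hmono hM (by omega)
      have := hgφ (E.left i) ⟨E.left_nonneg i, hlr.trans (E.right_le i)⟩ (E.right i)
        ⟨(E.left_nonneg i).trans hlr, E.right_le i⟩ hlr
      gcongr
  refine (Finset.sum_le_sum fun i _ => hterm i).trans ?_
  rw [Finset.sum_add_distrib, ← Finset.sum_div]
  have hMp := hpos M hM
  have h1 := E.sum_increments_le hφ hc
  have h2 : ∑ i : Fin E.card, (if i.val < M then 2 / lam (i.val + 1) else 0)
      ≤ 2 * ∑ k ∈ Finset.range M, 1 / lam (k + 1) := by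
    rw [Fin.sum_univ_eq_sum_range (fun i => if i < M then 2 / lam (i + 1) else 0),
      ← Finset.sum_filter, Finset.mul_sum]
    simp only [mul_one_div]
    refine Finset.sum_le_sum_of_subset_of_nonneg (fun i hi => ?_) fun i _ _ => ?_
    · exact Finset.mem_range.2 (Finset.mem_filter.1 hi).2
    · have := hpos (i + 1) (by omega)
      positivity
  gcongr

lemma sum_range_rpow_sub_one_le {s : ℝ} (h0 : 0 < s) (h1 : s ≤ 1) (M : ℕ) :
    ∑ k ∈ Finset.range M, ((k : ℝ) + 1) ^ (s - 1) ≤ (M : ℝ) ^ s / s := by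
  induction M with
  | zero => simp [h0.ne']
  | succ M ih =>
    rw [Finset.sum_range_succ]
    have hM : (0 : ℝ) < (M : ℝ) + 1 := by positivity
    have hb := rpow_one_add_le_one_add_mul_self (s := -(1 / ((M : ℝ) + 1)))
      (neg_le_neg ((div_le_one hM).2 (by linarith [M.cast_nonneg (α := ℝ)]))) h0.le h1
    have e : (M : ℝ) ^ s = ((M : ℝ) + 1) ^ s * (1 + -(1 / ((M : ℝ) + 1))) ^ s := by
      have e' : 1 + -(1 / ((M : ℝ) + 1)) = M / (M + 1) := by field_simp; ring
      rw [e', ← Real.mul_rpow hM.le (by positivity), mul_div_cancel₀ _ hM.ne']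
    have h2 : (M : ℝ) ^ s ≤ ((M : ℝ) + 1) ^ s - s * ((M : ℝ) + 1) ^ (s - 1) := by
      rw [e, Real.rpow_sub_one hM.ne']
      calc _ ≤ ((M : ℝ) + 1) ^ s * (1 + s * -(1 / ((M : ℝ) + 1))) := by gcongr
        _ = _ := by ring
    push_cast
    calc _ ≤ (M : ℝ) ^ s / s + ((M : ℝ) + 1) ^ (s - 1) := by gcongr
      _ ≤ (((M : ℝ) + 1) ^ s - s * ((M : ℝ) + 1) ^ (s - 1)) / s + ((M : ℝ) + 1) ^ (s - 1) := by
        gcongr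
      _ = _ := by field_simp; ring

lemma ratio_antitone {lam : ℕ → ℝ} {γ : ℝ} (hanti : ∀ k : ℕ, 1 ≤ k →
      lam (k + 1) / ((k + 1 : ℕ) : ℝ) ^ γ ≤ lam k / (k : ℝ) ^ γ) {k l : ℕ}
    (hk : 1 ≤ k) (hkl : k ≤ l) : lam l / (l : ℝ) ^ γ ≤ lam k / (k : ℝ) ^ γ := by
  induction l, hkl using Nat.le_induction with
  | base => exact le_rfl
  | succ l hl ih => exact (hanti l (hk.trans hl)).trans ih

/-- Monotonicity of the ratio gives `1 / λ_k ≤ (M ^ (1 - s) / λ_M) * k ^ (s - 1)` for `k ≤ M`, and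
the powers sum to at most `M ^ s / s`. -/
lemma sum_one_div_le {lam : ℕ → ℝ} {s : ℝ} (h0 : 0 < s) (h1 : s ≤ 1)
    (hpos : ∀ k : ℕ, 1 ≤ k → 0 < lam k)
    (hanti : ∀ k : ℕ, 1 ≤ k →
      lam (k + 1) / ((k + 1 : ℕ) : ℝ) ^ (1 - s) ≤ lam k / (k : ℝ) ^ (1 - s)) {M : ℕ}
    (hM : 1 ≤ M) :
    ∑ k ∈ Finset.range M, 1 / lam (k + 1) ≤ M / lam M / s := by
  have hMp := hpos M hM
  have hM0 : (0 : ℝ) < M := by exact_mod_cast hM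
  calc ∑ k ∈ Finset.range M, 1 / lam (k + 1)
      ≤ ∑ k ∈ Finset.range M, (M : ℝ) ^ (1 - s) / lam M * ((k : ℝ) + 1) ^ (s - 1) := by
        refine Finset.sum_le_sum fun k hk => ?_
        have hr := ratio_antitone hanti (k := k + 1) (l := M) (by omega)
          (by have := Finset.mem_range.1 hk; omega)
        have hk1 := hpos (k + 1) (by omega)
        push_cast at hr
        have e : ((k : ℝ) + 1) ^ (s - 1) = 1 / ((k : ℝ) + 1) ^ (1 - s) := by
          rw [← neg_sub 1 s, Real.rpow_neg (by positivity), one_div]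
        have hA : 0 < ((k : ℝ) + 1) ^ (1 - s) := by positivity
        have hB : 0 < (M : ℝ) ^ (1 - s) := by positivity
        rw [div_le_div_iff₀ hB hA] at hr
        rw [e, div_mul_div_comm, mul_one, div_le_div_iff₀ hk1 (by positivity)]
        linarith
    _ = (M : ℝ) ^ (1 - s) / lam M * ∑ k ∈ Finset.range M, ((k : ℝ) + 1) ^ (s - 1) := by
        rw [Finset.mul_sum]
    _ ≤ (M : ℝ) ^ (1 - s) / lam M * ((M : ℝ) ^ s / s) := by
        gcongr
        exact sum_range_rpow_sub_one_le h0 h1 M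
    _ = _ := by
        have : (M : ℝ) = (M : ℝ) ^ (1 - s) * (M : ℝ) ^ s := by
          rw [← Real.rpow_add hM0]; simp
        conv_rhs => rw [this]
        ring

/-! ### Truncated waves -/

/-- The phase of the kernel, truncated to `M` half-periods. -/
def clippedPhase (α : ℝ) (n M : ℕ) (t : ℝ) : ℝ :=
  max (M * Real.pi) (min ((2 * M : ℕ) * Real.pi) (kernelPhase α n t))

/-- `M` consecutive half-waves of the principal part of the kernel, extended by zero. -/
def wave (α : ℝ) (n M : ℕ) (t : ℝ) : ℝ := Real.sin (clippedPhase α n M t)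

/-- The `2π`-periodic extension of the restriction of `wave` to a period. -/
def periodicWave (α : ℝ) (n M : ℕ) (t : ℝ) : ℝ :=
  wave α n M (2 * Real.pi * Int.fract (t / (2 * Real.pi)))

@[fun_prop]
lemma continuous_kernelPhase (α : ℝ) (n : ℕ) : Continuous (kernelPhase α n) := by
  unfold kernelPhase; fun_prop

@[fun_prop]
lemma continuous_clippedPhase (α : ℝ) (n M : ℕ) : Continuous (clippedPhase α n M) := by
  unfold clippedPhase; fun_prop

@[fun_prop]
lemma continuous_wave (α : ℝ) (n M : ℕ) : Continuous (wave α n M) := by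
  unfold wave; fun_prop

lemma monotone_clippedPhase {α : ℝ} (hα : α ≤ 1) (n M : ℕ) : Monotone (clippedPhase α n M) := by
  intro x y hxy
  have : 0 ≤ (1 - α) / 2 := by linarith
  unfold clippedPhase kernelPhase
  gcongr

lemma clippedPhase_sub_le (α : ℝ) (n M : ℕ) (x y : ℝ) :
    clippedPhase α n M y - clippedPhase α n M x ≤ M * Real.pi := by
  have h1 : (M : ℝ) * Real.pi ≤ clippedPhase α n M x := le_max_left _ _
  have h2 : clippedPhase α n M y ≤ (2 * M : ℕ) * Real.pi :=
    max_le (by have := Real.pi_pos; gcongr; omega) (min_le_left _ _)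
  push_cast at h2
  linarith

lemma wave_eq_zero_of_le {α : ℝ} {n M : ℕ} {t : ℝ} (h : kernelPhase α n t ≤ M * Real.pi) :
    wave α n M t = 0 := by
  rw [wave, clippedPhase, max_eq_left ((min_le_right _ _).trans h), Real.sin_nat_mul_pi]

lemma wave_eq_zero_of_ge {α : ℝ} {n M : ℕ} {t : ℝ}
    (h : (2 * M : ℕ) * Real.pi ≤ kernelPhase α n t) : wave α n M t = 0 := by
  rw [wave, clippedPhase, min_eq_left h, max_eq_right, Real.sin_nat_mul_pi]
  have := Real.pi_pos
  gcongr
  omega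

lemma wave_eq_sin {α : ℝ} {n M : ℕ} {t : ℝ} (h1 : M * Real.pi ≤ kernelPhase α n t)
    (h2 : kernelPhase α n t ≤ (2 * M : ℕ) * Real.pi) :
    wave α n M t = Real.sin (kernelPhase α n t) := by
  rw [wave, clippedPhase, min_eq_right h2, max_eq_right h1]

lemma abs_periodicWave_le_one (α : ℝ) (n M : ℕ) (t : ℝ) : |periodicWave α n M t| ≤ 1 :=
  Real.abs_sin_le_one _

lemma periodicWave_add_two_pi (α : ℝ) (n M : ℕ) (t : ℝ) :
    periodicWave α n M (t + 2 * Real.pi) = periodicWave α n M t := by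
  have : (t + 2 * Real.pi) / (2 * Real.pi) = t / (2 * Real.pi) + 1 := by
    have := Real.pi_pos
    field_simp
  rw [periodicWave, this, Int.fract_add_one, periodicWave]

/-- The phase at `0` is `απ / 2`, below `Mπ`. Together with `wave_two_pi` this makes the periodic
extension continuous. -/
lemma wave_zero {α : ℝ} (hα : α ≤ 1) (n : ℕ) {M : ℕ} (hM : 1 ≤ M) : wave α n M 0 = 0 := by
  apply wave_eq_zero_of_le
  have h1 : (1 : ℝ) ≤ M := by exact_mod_cast hM
  have := Real.pi_pos
  rw [kernelPhase]
  nlinarith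

lemma wave_two_pi {α : ℝ} (hα : α ≤ 1) {n M : ℕ} (hM : M ≤ n) :
    wave α n M (2 * Real.pi) = 0 := by
  apply wave_eq_zero_of_ge
  have h1 : (M : ℝ) ≤ n := by exact_mod_cast hM
  have := Real.pi_pos
  rw [kernelPhase]
  push_cast
  nlinarith [mul_nonneg (sub_nonneg.2 hα) this.le]

lemma continuous_periodicWave {α : ℝ} (hα : α ≤ 1) {n M : ℕ} (hM : 1 ≤ M)
    (hMn : M ≤ n) : Continuous (periodicWave α n M) := by
  have h : Continuous ((fun u : ℝ => wave α n M (2 * Real.pi * u)) ∘ Int.fract) := by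
    refine ContinuousOn.comp_fract'' (by fun_prop) ?_
    simp [wave_zero hα n hM, wave_two_pi hα hMn]
  exact h.comp (continuous_id.div_const (2 * Real.pi))

lemma periodicWave_eq_wave {α : ℝ} (hα : α ≤ 1) {n M : ℕ} (hM : 1 ≤ M)
    (hMn : M ≤ n) {t : ℝ} (ht : t ∈ Set.Icc 0 (2 * Real.pi)) :
    periodicWave α n M t = wave α n M t := by
  have hp : 0 < 2 * Real.pi := Real.two_pi_pos
  rcases ht.2.eq_or_lt with rfl | hlt
  · rw [periodicWave, div_self hp.ne', Int.fract_one, mul_zero, wave_zero hα n hM,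
      wave_two_pi hα hMn]
  · rw [periodicWave, Int.fract_eq_self.2 ⟨div_nonneg ht.1 hp.le, (div_lt_one hp).2 hlt⟩,
      mul_div_cancel₀ _ hp.ne']

/-- The bound is independent of `n` and `M`, which is why `λ_M / M` is the weight used in the
blocks. -/
lemma weightedSum_periodicWave_le {α : ℝ} (hα : α ≤ 1) {n M : ℕ} (hM : 1 ≤ M)
    (hMn : M ≤ n) {lam : ℕ → ℝ} {s : ℝ} (hs0 : 0 < s) (hs1 : s ≤ 1)
    (hpos : ∀ k : ℕ, 1 ≤ k → 0 < lam k) (hmono : ∀ k : ℕ, 1 ≤ k → lam k ≤ lam (k + 1))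
    (hanti : ∀ k : ℕ, 1 ≤ k →
      lam (k + 1) / ((k + 1 : ℕ) : ℝ) ^ (1 - s) ≤ lam k / (k : ℝ) ^ (1 - s))
    (E : IntervalFamily) :
    lam M / M * E.weightedSum lam (periodicWave α n M) ≤ 2 / s + Real.pi := by
  have hMp := hpos M hM
  have hM0 : (0 : ℝ) < M := by exact_mod_cast hM
  have h := E.weightedSum_le hpos hmono (abs_periodicWave_le_one α n M)
    (monotone_clippedPhase hα n M) (continuous_clippedPhase α n M) (fun x hx y hy hxy => ?_) hM
  · have h2 := sum_one_div_le hs0 hs1 hpos hanti hM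
    have h3 := clippedPhase_sub_le α n M 0 (2 * Real.pi)
    calc _ ≤ lam M / M * (2 * (M / lam M / s) + M * Real.pi / lam M) := by
          gcongr
          exact h.trans (by gcongr)
      _ = _ := by field_simp
  · rw [periodicWave_eq_wave hα hM hMn hx, periodicWave_eq_wave hα hM hMn hy, wave, wave,
      ← abs_of_nonneg (sub_nonneg.2 (monotone_clippedPhase hα n M hxy))]
    exact Real.abs_sin_sub_sin_le _ _

/-! ### Lower bound for the integral of a wave against the kernel -/

lemma wave_mul_cesaroKernel_ge {α : ℝ} (h0 : 0 ≤ α) (hα : α < 1) (n : ℕ) {p q t : ℝ} (hp : 0 < p)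
    (hpt : p ≤ t) (htq : t ≤ q) (hq : q ≤ Real.pi) :
    2 * q ^ (α - 1) * ((n : ℝ) + 1) ^ α * Real.sin (kernelPhase α n t) ^ 2
        - Real.pi ^ 2 / ((n + 1) * p ^ 2)
      ≤ Real.sin (kernelPhase α n t) * cesaroKernel (-α) n t := by
  have ht0 : 0 < t := hp.trans_le hpt
  have htpi : t ≤ Real.pi := htq.trans hq
  have hpi := Real.pi_pos
  have hK := abs_cesaroKernel_sub_le h0 hα n ht0 htpi
  have hA := cesaroNumber_neg_pos hα n
  have hA' := cesaroNumber_neg_le_rpow h0 hα n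
  set S := 2 * Real.sin (t / 2) with hS
  set σ := Real.sin (kernelPhase α n t) with hσ
  -- Since `α - 1 < 0`, this upper bound on `S` serves the main term; the lower one, from Jordan's
  -- inequality, serves the error.
  have hSle : S ≤ q := by
    have := Real.sin_le (x := t / 2) (by linarith)
    linarith
  have hSge : 2 * p / Real.pi ≤ S := by
    have h := Real.mul_le_sin (x := t / 2) (by linarith) (by linarith)
    calc 2 * p / Real.pi ≤ 2 * t / Real.pi := by gcongr
      _ = 2 * (2 / Real.pi * (t / 2)) := by ring
      _ ≤ S := by rw [hS]; gcongr
  have hSpos : 0 < S := lt_of_lt_of_le (by positivity) hSge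
  have hSpow : q ^ (α - 1) ≤ S ^ (α - 1) :=
    Real.rpow_le_rpow_of_nonpos hSpos hSle (by linarith)
  have hAinv : ((n : ℝ) + 1) ^ α ≤ 1 / cesaroNumber (-α) n := by
    rw [le_div_iff₀ hA]
    calc _ ≤ ((n : ℝ) + 1) ^ α * ((n : ℝ) + 1) ^ (-α) := by gcongr
      _ = 1 := by rw [← Real.rpow_add (by positivity)]; simp
  have hq0 : 0 < q := ht0.trans_le htq
  have hmain : 2 * q ^ (α - 1) * ((n : ℝ) + 1) ^ α * σ ^ 2
      ≤ σ * (2 * S ^ (α - 1) * σ / cesaroNumber (-α) n) := by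
    calc _ ≤ 2 * S ^ (α - 1) * (1 / cesaroNumber (-α) n) * σ ^ 2 := by gcongr
      _ = _ := by ring
  have herr : 4 / ((n + 1) * S ^ 2) ≤ Real.pi ^ 2 / ((n + 1) * p ^ 2) := by
    calc _ ≤ 4 / (((n : ℝ) + 1) * (2 * p / Real.pi) ^ 2) := by gcongr
      _ = _ := by field_simp; ring
  have hσ1 : |σ| ≤ 1 := Real.abs_sin_le_one _
  have hd : |σ * (cesaroKernel (-α) n t - 2 * S ^ (α - 1) * σ / cesaroNumber (-α) n)|
      ≤ Real.pi ^ 2 / ((n + 1) * p ^ 2) := by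
    rw [abs_mul]
    calc _ ≤ 1 * (Real.pi ^ 2 / ((n + 1) * p ^ 2)) := by
          gcongr
          exact hK.trans herr
      _ = _ := one_mul _
  have := (abs_le.1 hd).1
  linarith

/-- The main term is at least `M ^ α / 2` and the error at most `4π / M`, which `M ≥ 64` makes at
most `1 / 4 ≤ M ^ α / 4`. The condition `2 * M ≤ n` keeps the wave inside `[0, π]`, where the kernel
estimate holds. -/
lemma integral_wave_mul_cesaroKernel_ge {α : ℝ} (h0 : 0 ≤ α) (hα : α < 1) {n M : ℕ}
    (hM : 64 ≤ M) (hMn : 2 * M ≤ n) :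
    (M : ℝ) ^ α / 4
      ≤ ∫ t in (0 : ℝ)..(2 * Real.pi), periodicWave α n M t * cesaroKernel (-α) n t := by
  have hpi := Real.pi_pos
  have hM0 : (64 : ℝ) ≤ M := by exact_mod_cast hM
  have hMn' : 2 * (M : ℝ) ≤ n := by exact_mod_cast hMn
  set ν : ℝ := n + (1 - α) / 2 with hν
  have hνn : (n : ℝ) ≤ ν := by rw [hν]; linarith
  have hνn1 : ν ≤ n + 1 := by rw [hν]; linarith
  have hν0 : 0 < ν := by linarith
  -- `p` and `q` are the points where the phase equals `Mπ` and `2Mπ`.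
  set p : ℝ := (M * Real.pi - α * Real.pi / 2) / ν with hp
  set q : ℝ := (2 * M * Real.pi - α * Real.pi / 2) / ν with hq
  have hphase : ∀ t, kernelPhase α n t = ν * t + α * Real.pi / 2 := fun t => rfl
  have hpp : M * Real.pi / (2 * ν) ≤ p := by
    rw [hp, div_le_div_iff₀ (by positivity) hν0]
    have : α * Real.pi ≤ M * Real.pi := by gcongr; linarith
    nlinarith
  have hp0 : 0 < p := lt_of_lt_of_le (by positivity) hpp
  have hqp : q - p = M * Real.pi / ν := by rw [hp, hq]; ring
  have hpq : p ≤ q := by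
    have : 0 ≤ M * Real.pi / ν := by positivity
    linarith
  have hq0 : 0 < q := by linarith
  have hqle : q ≤ 2 * M * Real.pi / ν := by
    rw [hq]
    gcongr
    have : 0 ≤ α * Real.pi := by positivity
    linarith
  have hqpi : q ≤ Real.pi := by
    refine hqle.trans ?_
    rw [div_le_iff₀ hν0, mul_comm]
    gcongr
    linarith
  have hθp : ν * p + α * Real.pi / 2 = M * Real.pi := by rw [hp]; field_simp; ring
  have hθq : ν * q + α * Real.pi / 2 = (2 * M : ℕ) * Real.pi := by
    rw [hq]; push_cast; field_simp; ring
  have hcont := (continuous_periodicWave hα.le (n := n) (M := M) (by omega) (by omega)).mul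
    (continuous_cesaroKernel (-α) n)
  have hint : ∀ a b, IntervalIntegrable (fun t => periodicWave α n M t * cesaroKernel (-α) n t)
    MeasureTheory.volume a b := fun a b => hcont.intervalIntegrable a b
  have hw : ∀ t ∈ Set.Icc 0 (2 * Real.pi), periodicWave α n M t = wave α n M t := fun t ht =>
    periodicWave_eq_wave hα.le (by omega) (by omega) ht
  have e1 : ∫ t in (0 : ℝ)..p, periodicWave α n M t * cesaroKernel (-α) n t = 0 := by
    refine intervalIntegral.integral_zero_ae (Filter.Eventually.of_forall fun t ht => ?_)
    rw [Set.uIoc_of_le hp0.le] at ht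
    rw [hw t ⟨ht.1.le, by linarith [ht.2]⟩, wave_eq_zero_of_le, zero_mul]
    rw [hphase, ← hθp]
    have := ht.2
    gcongr
  have e3 : ∫ t in q..(2 * Real.pi), periodicWave α n M t * cesaroKernel (-α) n t = 0 := by
    refine intervalIntegral.integral_zero_ae (Filter.Eventually.of_forall fun t ht => ?_)
    rw [Set.uIoc_of_le (by linarith)] at ht
    rw [hw t ⟨by linarith [ht.1], ht.2⟩, wave_eq_zero_of_ge, zero_mul]
    rw [hphase, ← hθq]
    have := ht.1
    gcongr
  have e2 : ∫ t in p..q, (2 * q ^ (α - 1) * ((n : ℝ) + 1) ^ α * Real.sin (kernelPhase α n t) ^ 2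
        - Real.pi ^ 2 / ((n + 1) * p ^ 2))
      ≤ ∫ t in p..q, periodicWave α n M t * cesaroKernel (-α) n t := by
    refine intervalIntegral.integral_mono_on hpq
      (Continuous.intervalIntegrable (by fun_prop) _ _) (hint _ _) fun t ht => ?_
    rw [hw t ⟨by linarith [ht.1], by linarith [ht.2]⟩, wave_eq_sin]
    · exact wave_mul_cesaroKernel_ge h0 hα n hp0 ht.1 ht.2 hqpi
    · rw [hphase, ← hθp]
      have := ht.1
      gcongr
    · rw [hphase, ← hθq]
      have := ht.2
      gcongr
  -- Over whole half-periods the mean of `sin ^ 2` is exactly `1 / 2`.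
  have hsin : ∫ t in p..q, Real.sin (kernelPhase α n t) ^ 2 = M * Real.pi / (2 * ν) := by
    simp_rw [hphase]
    rw [intervalIntegral.integral_comp_mul_add (fun u => Real.sin u ^ 2) hν0.ne', hθp, hθq,
      integral_sin_sq, Real.sin_nat_mul_pi, Real.sin_nat_mul_pi, smul_eq_mul]
    push_cast
    field_simp
    ring
  have e2' : ∫ t in p..q, (2 * q ^ (α - 1) * ((n : ℝ) + 1) ^ α * Real.sin (kernelPhase α n t) ^ 2
        - Real.pi ^ 2 / ((n + 1) * p ^ 2))
      = 2 * q ^ (α - 1) * ((n : ℝ) + 1) ^ α * (M * Real.pi / (2 * ν))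
        - (M * Real.pi / ν) * (Real.pi ^ 2 / ((n + 1) * p ^ 2)) := by
    rw [intervalIntegral.integral_sub (Continuous.intervalIntegrable (by fun_prop) _ _)
      (Continuous.intervalIntegrable (by fun_prop) _ _), intervalIntegral.integral_const_mul, hsin,
      intervalIntegral.integral_const, hqp, smul_eq_mul]
  have hsplit : ∫ t in (0 : ℝ)..(2 * Real.pi), periodicWave α n M t * cesaroKernel (-α) n t
      = ∫ t in p..q, periodicWave α n M t * cesaroKernel (-α) n t := by
    rw [← intervalIntegral.integral_add_adjacent_intervals (hint 0 p) (hint p (2 * Real.pi)),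
      ← intervalIntegral.integral_add_adjacent_intervals (hint p q) (hint q (2 * Real.pi)), e1, e3]
    ring
  have hMα : 1 ≤ (M : ℝ) ^ α := Real.one_le_rpow (by linarith) h0
  have hmain : (M : ℝ) ^ α / 2 ≤ 2 * q ^ (α - 1) * ((n : ℝ) + 1) ^ α * (M * Real.pi / (2 * ν)) := by
    have hM' : (0 : ℝ) < M := by linarith
    have k1 : (2 * M * Real.pi / ν) ^ (α - 1) ≤ q ^ (α - 1) :=
      Real.rpow_le_rpow_of_nonpos hq0 hqle (by linarith)
    have k2 : ν ^ α ≤ ((n : ℝ) + 1) ^ α := by gcongr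
    have k3 : 1 ≤ (2 * Real.pi) ^ α := Real.one_le_rpow (by linarith [Real.pi_gt_three]) h0
    have k4 : (2 * M * Real.pi / ν) ^ (α - 1) = (2 * Real.pi) ^ α * (M : ℝ) ^ α / ν ^ α
        / (2 * M * Real.pi / ν) := by
      rw [Real.rpow_sub_one (by positivity), Real.div_rpow (by positivity) hν0.le,
        show 2 * (M : ℝ) * Real.pi = 2 * Real.pi * M by ring,
        Real.mul_rpow (by positivity) hM'.le]
    calc (M : ℝ) ^ α / 2 ≤ (2 * Real.pi) ^ α * (M : ℝ) ^ α / 2 := by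
          gcongr
          exact le_mul_of_one_le_left (by positivity) k3
      _ = 2 * (2 * M * Real.pi / ν) ^ (α - 1) * ν ^ α * (M * Real.pi / (2 * ν)) := by
          rw [k4]
          have : 0 < ν ^ α := by positivity
          field_simp
      _ ≤ _ := by gcongr
  have herr : (M * Real.pi / ν) * (Real.pi ^ 2 / ((n + 1) * p ^ 2)) ≤ 1 / 4 := by
    have hM' : (0 : ℝ) < M := by linarith
    calc _ ≤ (M * Real.pi / ν) * (Real.pi ^ 2 / (ν * (M * Real.pi / (2 * ν)) ^ 2)) := by gcongr
      _ = 4 * Real.pi / M := by field_simp; ring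
      _ ≤ 4 * 4 / 64 := by
          gcongr
          exact Real.pi_le_four
      _ = 1 / 4 := by norm_num
  rw [hsplit]
  refine le_trans ?_ e2
  rw [e2']
  linarith

/-! ### The blocks -/

/-- The phase ranges `[Mπ, 2Mπ]` and `[M'π, 2M'π]` share at most an endpoint, where the sine
vanishes. -/
lemma periodicWave_eq_zero_or {α : ℝ} {n M M' : ℕ} (h : 2 * M ≤ M') (t : ℝ) :
    periodicWave α n M t = 0 ∨ periodicWave α n M' t = 0 := by
  unfold periodicWave
  set u := 2 * Real.pi * Int.fract (t / (2 * Real.pi))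
  rcases le_total (kernelPhase α n u) (M' * Real.pi) with h1 | h1
  · exact Or.inr (wave_eq_zero_of_le h1)
  · refine Or.inl (wave_eq_zero_of_ge (le_trans ?_ h1))
    have := Real.pi_pos
    gcongr

lemma exists_forall_ne_periodicWave_eq_zero (α : ℝ) (n : ℕ) (t : ℝ) :
    ∃ k : ℕ, ∀ l ≠ k, periodicWave α n (2 ^ l) t = 0 := by
  have key : ∀ {k l : ℕ}, k < l →
      periodicWave α n (2 ^ k) t = 0 ∨ periodicWave α n (2 ^ l) t = 0 := fun {k l} hkl => by
    refine periodicWave_eq_zero_or ?_ t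
    rw [← pow_succ']
    exact Nat.pow_le_pow_right (by norm_num) hkl
  by_cases h : ∃ k, periodicWave α n (2 ^ k) t ≠ 0
  · obtain ⟨k, hk⟩ := h
    refine ⟨k, fun l hl => ?_⟩
    rcases lt_or_gt_of_ne hl with hlt | hlt
    · exact (key hlt).resolve_right hk
    · exact (key hlt).resolve_left hk
  · push Not at h
    exact ⟨0, fun l _ => h l⟩

/-- The sum of the tensor products of dyadic waves, with weights `λ_{2^k} / 2^k`. -/
def blockSum (lam : ℕ → ℝ) (α β : ℝ) (n : ℕ) (x y : ℝ) : ℝ :=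
  ∑ k ∈ Finset.Ico 6 n, lam (2 ^ k) / (2 ^ k : ℕ) *
    (periodicWave α (2 ^ n) (2 ^ k) x * periodicWave β (2 ^ n) (2 ^ k) y)

lemma blockSum_swap (lam : ℕ → ℝ) (α β : ℝ) (n : ℕ) (x y : ℝ) :
    blockSum lam α β n x y = blockSum lam β α n y x := by
  simp only [blockSum, mul_comm (periodicWave α _ _ x)]

lemma blockSum_add_two_pi (lam : ℕ → ℝ) (α β : ℝ) (n : ℕ) (x y : ℝ) :
    blockSum lam α β n (x + 2 * Real.pi) y = blockSum lam α β n x y := by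
  simp only [blockSum, periodicWave_add_two_pi]

/-- For fixed `y` at most one factor in `y` is nonzero, so a horizontal section is a multiple of a
single wave. -/
lemma blockSum_eq_mul (lam : ℕ → ℝ) (α β : ℝ) (n : ℕ) (y : ℝ) :
    (∀ x, blockSum lam α β n x y = 0) ∨ ∃ k ∈ Finset.Ico 6 n, ∃ d : ℝ, |d| ≤ 1 ∧
      ∀ x, blockSum lam α β n x y
        = d * (lam (2 ^ k) / (2 ^ k : ℕ)) * periodicWave α (2 ^ n) (2 ^ k) x := by
  obtain ⟨k, hk⟩ := exists_forall_ne_periodicWave_eq_zero β (2 ^ n) y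
  by_cases hkn : k ∈ Finset.Ico 6 n
  · refine Or.inr ⟨k, hkn, periodicWave β (2 ^ n) (2 ^ k) y, abs_periodicWave_le_one _ _ _ _,
      fun x => ?_⟩
    rw [blockSum, Finset.sum_eq_single_of_mem k hkn fun l _ hl => by simp [hk l hl]]
    ring
  · refine Or.inl fun x => Finset.sum_eq_zero fun l hl => ?_
    rw [hk l fun h => hkn (h ▸ hl)]
    simp

lemma continuous_periodicWave_two_pow {α : ℝ} (hα : α ≤ 1) {k n : ℕ} (hk : k ≤ n) :
    Continuous (periodicWave α (2 ^ n) (2 ^ k)) :=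
  continuous_periodicWave hα Nat.one_le_two_pow (Nat.pow_le_pow_right (by norm_num) hk)

lemma continuous_blockSum (lam : ℕ → ℝ) {α β : ℝ} (hα : α ≤ 1) (hβ : β ≤ 1) (n : ℕ) :
    Continuous fun p : ℝ × ℝ => blockSum lam α β n p.1 p.2 := by
  refine continuous_finsetSum _ fun k hk => ?_
  have hkn := (Finset.mem_Ico.1 hk).2.le
  exact continuous_const.mul (((continuous_periodicWave_two_pow hα hkn).comp continuous_fst).mul
    ((continuous_periodicWave_two_pow hβ hkn).comp continuous_snd))

lemma IntervalFamily.weightedSum_const_mul (E : IntervalFamily) (lam : ℕ → ℝ) (c : ℝ)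
    (g : ℝ → ℝ) : E.weightedSum lam (fun x => c * g x) = |c| * E.weightedSum lam g := by
  simp only [weightedSum, ← mul_sub, abs_mul, mul_div_assoc, Finset.mul_sum]

lemma IntervalFamily.weightedSum_nonneg (E : IntervalFamily) {lam : ℕ → ℝ}
    (hpos : ∀ k : ℕ, 1 ≤ k → 0 < lam k) (g : ℝ → ℝ) : 0 ≤ E.weightedSum lam g :=
  Finset.sum_nonneg fun i _ => div_nonneg (abs_nonneg _) (hpos _ (by omega)).le

lemma weightedSum_blockSum_le {lam : ℕ → ℝ} {s : ℝ} (hs0 : 0 < s) (hs1 : s ≤ 1)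
    (hpos : ∀ k : ℕ, 1 ≤ k → 0 < lam k)
    (hanti : ∀ k : ℕ, 1 ≤ k →
      lam (k + 1) / ((k + 1 : ℕ) : ℝ) ^ (1 - s) ≤ lam k / (k : ℝ) ^ (1 - s))
    (hmono : ∀ k : ℕ, 1 ≤ k → lam k ≤ lam (k + 1)) {α : ℝ}
    (hα : α ≤ 1) (β : ℝ) (n : ℕ) (y : ℝ) (E : IntervalFamily) :
    E.weightedSum lam (fun x => blockSum lam α β n x y) ≤ 2 / s + Real.pi := by
  rcases blockSum_eq_mul lam α β n y with h | ⟨k, hk, d, hd, h⟩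
  · simp only [h]
    have : 0 ≤ 2 / s + Real.pi := by have := Real.pi_pos; positivity
    simpa [IntervalFamily.weightedSum] using this
  · have hc : 0 < lam (2 ^ k) / (2 ^ k : ℕ) :=
      div_pos (hpos _ Nat.one_le_two_pow) (by positivity)
    simp only [h]
    rw [E.weightedSum_const_mul, abs_mul, abs_of_pos hc, mul_assoc]
    have hw := weightedSum_periodicWave_le hα (n := 2 ^ n) (M := 2 ^ k) Nat.one_le_two_pow
      (Nat.pow_le_pow_right (by norm_num) (Finset.mem_Ico.1 hk).2.le) hs0 hs1 hpos hmono hanti E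
    refine le_trans (mul_le_of_le_one_left ?_ hd) hw
    exact mul_nonneg hc.le (E.weightedSum_nonneg hpos _)

lemma abs_blockSum_le {lam : ℕ → ℝ} {s : ℝ} (hs0 : 0 ≤ s) (hpos : ∀ k : ℕ, 1 ≤ k → 0 < lam k)
    (hanti : ∀ k : ℕ, 1 ≤ k →
      lam (k + 1) / ((k + 1 : ℕ) : ℝ) ^ (1 - s) ≤ lam k / (k : ℝ) ^ (1 - s))
    (α β : ℝ) (n : ℕ) (x y : ℝ) : |blockSum lam α β n x y| ≤ lam 1 := by
  have hl1 := hpos 1 le_rfl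
  rcases blockSum_eq_mul lam α β n y with h | ⟨k, hk, d, hd, h⟩
  · simpa [h] using hl1.le
  · have hp := hpos (2 ^ k) Nat.one_le_two_pow
    have hM : (1 : ℝ) ≤ (2 ^ k : ℕ) := by exact_mod_cast Nat.one_le_two_pow
    have hM0 : (0 : ℝ) < (2 ^ k : ℕ) := by linarith
    have hc : lam (2 ^ k) / (2 ^ k : ℕ) ≤ lam 1 := by
      have hr := ratio_antitone hanti (k := 1) (l := 2 ^ k) le_rfl Nat.one_le_two_pow
      rw [Nat.cast_one, Real.one_rpow, div_one] at hr
      refine le_trans ?_ hr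
      gcongr
      calc _ ≤ ((2 ^ k : ℕ) : ℝ) ^ (1 : ℝ) :=
            Real.rpow_le_rpow_of_exponent_le hM (by linarith)
        _ = _ := Real.rpow_one _
    rw [h, abs_mul, abs_mul, abs_of_pos (div_pos hp hM0)]
    have hw := abs_periodicWave_le_one α (2 ^ n) (2 ^ k) x
    calc _ ≤ 1 * lam 1 * 1 := by gcongr
      _ = lam 1 := by ring

/-- Each tensor term factors into two one-dimensional integrals. The range `6 ≤ k < n` is exactly
what gives `64 ≤ 2 ^ k` and `2 * 2 ^ k ≤ 2 ^ n`. -/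
lemma kernelIntegral_blockSum_ge {lam : ℕ → ℝ} (hpos : ∀ k : ℕ, 1 ≤ k → 0 < lam k) {α β : ℝ}
    (hα0 : 0 ≤ α) (hα : α < 1) (hβ0 : 0 ≤ β) (hβ : β < 1) (n : ℕ) :
    (∑ k ∈ Finset.Ico 6 n, (2 ^ k : ℕ) * (lam (2 ^ k) / ((2 ^ k : ℕ) : ℝ) ^ (2 - (α + β)))) / 16
      ≤ kernelIntegral (-α) (-β) (2 ^ n) (2 ^ n) (blockSum lam α β n) := by
  -- Attaching membership supplies the bound on `k` needed for each wave to be continuous.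
  have e : blockSum lam α β n = fun x y => ∑ k ∈ (Finset.Ico 6 n).attach,
      lam (2 ^ k.1) / (2 ^ k.1 : ℕ) *
        (periodicWave α (2 ^ n) (2 ^ k.1) x * periodicWave β (2 ^ n) (2 ^ k.1) y) := by
    funext x y
    rw [Finset.sum_attach (Finset.Ico 6 n) fun k => lam (2 ^ k) / (2 ^ k : ℕ) *
      (periodicWave α (2 ^ n) (2 ^ k) x * periodicWave β (2 ^ n) (2 ^ k) y)]
    rfl
  rw [e, kernelIntegral_sum _ _ _ _ _ _ (fun k : Finset.Ico 6 n => periodicWave α (2 ^ n) (2 ^ k.1))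
    (fun k : Finset.Ico 6 n => periodicWave β (2 ^ n) (2 ^ k.1))
    (fun k => continuous_periodicWave_two_pow hα.le (Finset.mem_Ico.1 k.2).2.le)
    (fun k => continuous_periodicWave_two_pow hβ.le (Finset.mem_Ico.1 k.2).2.le),
    ← Finset.sum_attach, Finset.sum_div]
  refine Finset.sum_le_sum fun k _ => ?_
  obtain ⟨k, hk⟩ := k
  obtain ⟨hk6, hkn⟩ := Finset.mem_Ico.1 hk
  have h64 : 64 ≤ 2 ^ k := (Nat.pow_le_pow_right (by norm_num) hk6 : 2 ^ 6 ≤ 2 ^ k)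
  have h2 : 2 * 2 ^ k ≤ 2 ^ n := by
    rw [← pow_succ']
    exact Nat.pow_le_pow_right (by norm_num) hkn
  have hI := integral_wave_mul_cesaroKernel_ge hα0 hα h64 h2
  have hJ := integral_wave_mul_cesaroKernel_ge hβ0 hβ h64 h2
  rw [kernelIntegral_mul]
  have hp := hpos (2 ^ k) Nat.one_le_two_pow
  have hM0 : (0 : ℝ) < (2 ^ k : ℕ) := by positivity
  generalize 2 ^ k = M at *
  have e2 : (M : ℝ) ^ (2 - (α + β)) = M ^ 2 / ((M : ℝ) ^ α * (M : ℝ) ^ β) := by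
    rw [Real.rpow_sub hM0, Real.rpow_add hM0, Real.rpow_two]
  have hA : 0 < (M : ℝ) ^ α := by positivity
  have hB : 0 < (M : ℝ) ^ β := by positivity
  calc _ = lam M / M * ((M : ℝ) ^ α / 4 * ((M : ℝ) ^ β / 4)) := by
        rw [e2]
        field_simp
        norm_num
    _ ≤ _ := by
        have := hI.trans' (by positivity : 0 ≤ (M : ℝ) ^ α / 4)
        gcongr

lemma exists_lt_kernelIntegral_blockSum {lam : ℕ → ℝ} (hpos : ∀ k : ℕ, 1 ≤ k → 0 < lam k)
    {α β : ℝ} (hα0 : 0 ≤ α) (hα : α < 1) (hβ0 : 0 ≤ β) (hβ : β < 1)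
    (hanti : ∀ k : ℕ, 1 ≤ k →
      lam (k + 1) / ((k + 1 : ℕ) : ℝ) ^ (1 - (α + β)) ≤ lam k / (k : ℝ) ^ (1 - (α + β)))
    (hdiv : Tendsto (fun n : ℕ => ∑ k ∈ Finset.Icc 1 n, lam k / (k : ℝ) ^ (2 - (α + β)))
      atTop atTop) (C : ℝ) :
    ∃ n, C < kernelIntegral (-α) (-β) (2 ^ n) (2 ^ n) (blockSum lam α β n) := by
  set a : ℕ → ℝ := fun k => lam k / (k : ℝ) ^ (2 - (α + β)) with ha
  -- The condensed terms with `k < 6`, absent from the blocks; a fixed amount that does not affect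
  -- divergence.
  set D := ∑ k ∈ Finset.range 6, (2 ^ k : ℕ) * a (2 ^ k)
  have hanti' : ∀ ⦃m n : ℕ⦄, 0 < m → m ≤ n → a n ≤ a m := by
    intro m n hm hmn
    have hn : 0 < n := hm.trans_le hmn
    have h1 := ratio_antitone hanti hm hmn
    have e : ∀ k : ℕ, 0 < k → a k = lam k / (k : ℝ) ^ (1 - (α + β)) / k := fun k hk => by
      have hk' : (0 : ℝ) < k := by exact_mod_cast hk
      rw [ha, div_div, ← Real.rpow_add_one hk'.ne']
      simp only
      congr 2
      ring
    have hm' : (0 : ℝ) < m := by exact_mod_cast hm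
    have := hpos m hm
    rw [e m hm, e n hn]
    gcongr
  obtain ⟨n, hn6, hn⟩ : ∃ n, 6 ≤ n ∧ 16 * C + D < ∑ k ∈ Finset.Icc 1 (2 ^ n - 1), a k := by
    have ht : Tendsto (fun n : ℕ => 2 ^ n - 1) atTop atTop :=
      tendsto_atTop_mono (fun n => Nat.le_sub_one_of_lt n.lt_two_pow_self) tendsto_id
    obtain ⟨n, hn⟩ := (((hdiv.comp ht).eventually_gt_atTop (16 * C + D)).and
      (eventually_ge_atTop 6)).exists
    exact ⟨n, hn.2, hn.1⟩
  refine ⟨n, lt_of_lt_of_le ?_ (kernelIntegral_blockSum_ge hpos hα0 hα hβ0 hβ n)⟩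
  have hcond := Finset.le_sum_condensed' hanti' n
  have hI : Finset.Icc 1 (2 ^ n - 1) = Finset.Ico 1 (2 ^ n) := by
    ext k
    have : 0 < 2 ^ n := by positivity
    simp only [Finset.mem_Icc, Finset.mem_Ico]
    omega
  rw [hI] at hn
  simp only [nsmul_eq_mul] at hcond
  rw [← Finset.sum_range_add_sum_Ico _ hn6] at hcond
  rw [lt_div_iff₀ (by norm_num)]
  have : 16 * C + D < D + ∑ k ∈ Finset.Ico 6 n, (2 ^ k : ℕ) * a (2 ^ k) := hn.trans_le hcond
  linarith

/-! ### Condensation of singularities -/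

/-- The superposition `∑ⱼ aⱼ fⱼ` of a sequence of functions with coefficients in `ℓ¹`. -/
def superposition (f : ℕ → ℝ → ℝ → ℝ) (a : lp (fun _ : ℕ => ℝ) 1) (x y : ℝ) : ℝ :=
  ∑' j, a j * f j x y

lemma hasSum_abs_lp (a : lp (fun _ : ℕ => ℝ) 1) : HasSum (fun j => |a j|) ‖a‖ := by
  simpa using lp.hasSum_norm (p := 1) (by simp) a

lemma summable_mul_of_abs_le (a : lp (fun _ : ℕ => ℝ) 1) {g : ℕ → ℝ} {B : ℝ}
    (hg : ∀ j, |g j| ≤ B) : Summable fun j => a j * g j := by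
  refine Summable.of_norm_bounded ((hasSum_abs_lp a).summable.mul_right B) fun j => ?_
  rw [norm_mul, Real.norm_eq_abs, Real.norm_eq_abs]
  have := hg j
  gcongr

lemma continuous_superposition {f : ℕ → ℝ → ℝ → ℝ} {B : ℝ}
    (hf : ∀ j, Continuous fun p : ℝ × ℝ => f j p.1 p.2) (hB : ∀ j x y, |f j x y| ≤ B)
    (a : lp (fun _ : ℕ => ℝ) 1) :
    Continuous fun p : ℝ × ℝ => superposition f a p.1 p.2 := by
  refine continuous_tsum (fun j => continuous_const.mul (hf j))
    ((hasSum_abs_lp a).summable.mul_right B) fun j p => ?_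
  rw [norm_mul, Real.norm_eq_abs, Real.norm_eq_abs]
  have := hB j p.1 p.2
  gcongr

lemma abs_superposition_le {f : ℕ → ℝ → ℝ → ℝ} {B : ℝ} (hB : ∀ j x y, |f j x y| ≤ B)
    (a : lp (fun _ : ℕ => ℝ) 1) (x y : ℝ) : |superposition f a x y| ≤ ‖a‖ * B := by
  rw [← Real.norm_eq_abs]
  refine tsum_of_norm_bounded ((hasSum_abs_lp a).mul_right B) fun j => ?_
  rw [norm_mul, Real.norm_eq_abs, Real.norm_eq_abs]
  have := hB j x y
  gcongr

lemma superposition_add_smul {f : ℕ → ℝ → ℝ → ℝ} {B : ℝ} (hB : ∀ j x y, |f j x y| ≤ B)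
    (a b : lp (fun _ : ℕ => ℝ) 1) (c : ℝ) (x y : ℝ) :
    superposition f (a + c • b) x y = superposition f a x y + c * superposition f b x y := by
  have ha := summable_mul_of_abs_le a fun j => hB j x y
  have hb := summable_mul_of_abs_le b fun j => hB j x y
  rw [superposition, superposition, superposition, ← tsum_mul_left,
    ← ha.tsum_add (hb.mul_left c)]
  refine tsum_congr fun j => ?_
  change (a j + c * b j) * f j x y = _
  ring

lemma superposition_single (f : ℕ → ℝ → ℝ → ℝ) (n : ℕ) :
    superposition f (lp.single 1 n 1) = f n := by
  funext x y
  rw [superposition, tsum_eq_single n fun j hj => by simp [lp.single_apply, hj]]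
  simp [lp.single_apply]

/-- The triangle inequality on each interval, then an exchange of the finite sum over intervals with
the `ℓ¹` series. -/
lemma IntervalFamily.weightedSum_tsum_le (E : IntervalFamily) {lam : ℕ → ℝ}
    (hpos : ∀ k : ℕ, 1 ≤ k → 0 < lam k) (a : lp (fun _ : ℕ => ℝ) 1) {g : ℕ → ℝ → ℝ} {B V : ℝ}
    (hB : ∀ j x, |g j x| ≤ B) (hV : ∀ j, E.weightedSum lam (g j) ≤ V) :
    E.weightedSum lam (fun x => ∑' j, a j * g j x) ≤ ‖a‖ * V := by
  have hsum : ∀ x, Summable fun j => a j * g j x := fun x =>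
    summable_mul_of_abs_le a fun j => hB j x
  have hd : ∀ i : Fin E.card, Summable fun j =>
      |a j| * (|g j (E.right i) - g j (E.left i)| / lam (i.val + 1)) := fun i => by
    have h1 := ((hsum (E.right i)).sub (hsum (E.left i))).abs.div_const (lam (i.val + 1))
    refine h1.congr fun j => ?_
    rw [← mul_sub, abs_mul, mul_div_assoc]
  have hle : E.weightedSum lam (fun x => ∑' j, a j * g j x)
      ≤ ∑ i : Fin E.card, ∑' j,
        |a j| * (|g j (E.right i) - g j (E.left i)| / lam (i.val + 1)) := by
    refine Finset.sum_le_sum fun i _ => ?_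
    have hi := hpos (i.val + 1) (by omega)
    rw [← (hsum _).tsum_sub (hsum _), div_le_iff₀ hi, ← tsum_mul_right, ← Real.norm_eq_abs]
    refine tsum_of_norm_bounded ((hd i).mul_right _).hasSum fun j => ?_
    rw [← mul_sub, norm_mul, Real.norm_eq_abs, Real.norm_eq_abs, mul_assoc,
      div_mul_cancel₀ _ hi.ne']
  refine hle.trans ?_
  rw [← Summable.tsum_finsetSum fun i _ => hd i]
  refine (Summable.tsum_le_tsum (fun j => ?_) (summable_sum fun i _ => hd i)
    ((hasSum_abs_lp a).summable.mul_right V)).trans_eq ((hasSum_abs_lp a).mul_right V).tsum_eq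
  rw [← Finset.mul_sum]
  exact mul_le_mul_of_nonneg_left (hV j) (abs_nonneg _)

/-- If the kernel integrals of a uniformly bounded sequence are unbounded, then so are those of
some superposition of the sequence. -/
lemma exists_superposition_unbounded (a b : ℝ) (N : ℕ → ℕ) {f : ℕ → ℝ → ℝ → ℝ} {B : ℝ}
    (hf : ∀ j, Continuous fun p : ℝ × ℝ => f j p.1 p.2) (hB : ∀ j x y, |f j x y| ≤ B)
    (hunb : ∀ C, ∃ n, C < kernelIntegral a b (N n) (N n) (f n)) :
    ∃ c : lp (fun _ : ℕ => ℝ) 1, ¬ ∃ C : ℝ, ∀ n,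
      |kernelIntegral a b (N n) (N n) (superposition f c)| ≤ C := by
  by_contra hcon
  push Not at hcon
  choose K hK0 hK using fun n => exists_abs_kernelIntegral_le a b (N n) (N n)
  have hlin : ∀ n (u v : lp (fun _ : ℕ => ℝ) 1) (c : ℝ),
      kernelIntegral a b (N n) (N n) (superposition f (u + c • v))
        = kernelIntegral a b (N n) (N n) (superposition f u)
          + c * kernelIntegral a b (N n) (N n) (superposition f v) := fun n u v c => by
    rw [← kernelIntegral_add_smul a b (N n) (N n) (continuous_superposition hf hB u)
      (continuous_superposition hf hB v)]
    congr 1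
    funext x y
    exact superposition_add_smul hB u v c x y
  have hzero : ∀ n, kernelIntegral a b (N n) (N n) (superposition f 0) = 0 := fun n => by
    have := hlin n 0 0 1
    simp only [smul_zero, add_zero] at this
    linarith
  let L : ℕ → lp (fun _ : ℕ => ℝ) 1 →L[ℝ] ℝ := fun n =>
    LinearMap.mkContinuous
      { toFun := fun u => kernelIntegral a b (N n) (N n) (superposition f u)
        map_add' := fun u v => by simpa using hlin n u v 1
        map_smul' := fun c v => by simpa [hzero] using hlin n 0 v c } (K n * B) fun u => by
      refine (hK n _ _ (abs_superposition_le hB u)).trans_eq ?_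
      ring
  have hL : ∀ n u, L n u = kernelIntegral a b (N n) (N n) (superposition f u) := fun n u => rfl
  -- Pointwise boundedness would bound all `‖L n‖` by one `C`, but the unit vector at `n` is sent to
  -- the kernel integral of `f n`, which exceeds `C` for some `n`.
  obtain ⟨C, hC⟩ := banach_steinhaus (g := L) fun u => by
    obtain ⟨C, hC⟩ := hcon u
    exact ⟨C, fun n => by rw [hL]; exact hC n⟩
  obtain ⟨n, hn⟩ := hunb C
  have h1 := (L n).le_of_opNorm_le (hC n) (lp.single 1 n 1)
  rw [hL, superposition_single, lp.norm_single (by simp), norm_one, mul_one] at h1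
  exact absurd ((le_abs_self _).trans h1) (not_le.2 hn)

lemma isPLambdaBV_superposition {lam : ℕ → ℝ} (hpos : ∀ k : ℕ, 1 ≤ k → 0 < lam k)
    {f : ℕ → ℝ → ℝ → ℝ} {B V : ℝ} (hB : ∀ j x y, |f j x y| ≤ B)
    (hp₁ : ∀ j x y, f j (x + 2 * Real.pi) y = f j x y)
    (hp₂ : ∀ j x y, f j x (y + 2 * Real.pi) = f j x y)
    (hV₁ : ∀ j y (E : IntervalFamily), E.weightedSum lam (fun x => f j x y) ≤ V)
    (hV₂ : ∀ j x (E : IntervalFamily), E.weightedSum lam (fun y => f j x y) ≤ V)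
    (a : lp (fun _ : ℕ => ℝ) 1) : IsPLambdaBV lam (superposition f a) where
  periodic₁ x y := by simp only [superposition, hp₁]
  periodic₂ x y := by simp only [superposition, hp₂]
  variation_lt_top := by
    refine ENNReal.add_lt_top.2 ⟨?_, ?_⟩
    · refine lt_of_le_of_lt (iSup₂_le fun y _ => iSup_le fun E => ?_)
        (ENNReal.ofReal_lt_top (r := ‖a‖ * V))
      exact ENNReal.ofReal_le_ofReal (E.weightedSum_tsum_le hpos a (fun j x => hB j x y)
        fun j => hV₁ j y E)
    · refine lt_of_le_of_lt (iSup₂_le fun x _ => iSup_le fun E => ?_)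
        (ENNReal.ofReal_lt_top (r := ‖a‖ * V))
      exact ENNReal.ofReal_le_ofReal (E.weightedSum_tsum_le hpos a (fun j y => hB j x y)
        fun j => hV₂ j x E)

end DoubleFourier

end

/-! ### Assembly of the theorem -/

theorem theorem2 (α β : ℝ) (hα : α ∈ Set.Ioo (0 : ℝ) 1) (hβ : β ∈ Set.Ioo (0 : ℝ) 1)
    (hαβ : α + β < 1) (lam : ℕ → ℝ)
    (hpos : ∀ k : ℕ, 1 ≤ k → 0 < lam k)
    (hmono : ∀ k : ℕ, 1 ≤ k → lam k ≤ lam (k + 1))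
    (hanti : ∀ k : ℕ, 1 ≤ k →
      lam (k + 1) / ((k + 1 : ℕ) : ℝ) ^ (1 - (α + β)) ≤ lam k / (k : ℝ) ^ (1 - (α + β)))
    (hzero : Filter.Tendsto (fun k : ℕ => lam k / (k : ℝ) ^ (1 - (α + β)))
      Filter.atTop (nhds 0))
    (hdiv : Filter.Tendsto
      (fun n : ℕ => ∑ k ∈ Finset.Icc 1 n, lam k / (k : ℝ) ^ (2 - (α + β)))
      Filter.atTop Filter.atTop) :
    ∃ f : ℝ → ℝ → ℝ, Continuous (fun p : ℝ × ℝ => f p.1 p.2) ∧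
      DoubleFourier.IsPLambdaBV lam f ∧
      (¬ ∃ C : ℝ, ∀ N : ℕ, ‖DoubleFourier.cesaroMean (-α) (-β) f N N 0 0‖ ≤ C) ∧
      (¬ ∃ L : ℂ, Filter.Tendsto
        (fun N : ℕ => DoubleFourier.cesaroMean (-α) (-β) f N N 0 0)
        Filter.atTop (nhds L)) := by
  open DoubleFourier in
  have hs0 : 0 < α + β := add_pos hα.1 hβ.1
  have hc := continuous_blockSum lam hα.2.le hβ.2.le
  have hB := abs_blockSum_le hs0.le hpos hanti α β
  obtain ⟨c, hunb⟩ := exists_superposition_unbounded (-α) (-β) (fun n => 2 ^ n) hc hB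
    (exists_lt_kernelIntegral_blockSum hpos hα.1.le hα.2 hβ.1.le hβ.2 hanti hdiv)
  have hcont := continuous_superposition hc hB c
  have hunb' : ¬ ∃ C : ℝ, ∀ N : ℕ,
      ‖cesaroMean (-α) (-β) (superposition (blockSum lam α β) c) N N 0 0‖ ≤ C := by
    rintro ⟨C, hC⟩
    refine hunb ⟨4 * Real.pi ^ 2 * C, fun n => ?_⟩
    have h := hC (2 ^ n)
    have hpi : 0 < 4 * Real.pi ^ 2 := by have := Real.pi_pos; positivity
    rw [cesaroMean_zero_eq _ _ hcont, Complex.norm_real, Real.norm_eq_abs, abs_mul,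
      abs_of_pos (one_div_pos.2 hpi), div_mul_eq_mul_div, one_mul, div_le_iff₀ hpi] at h
    linarith
  refine ⟨superposition (blockSum lam α β) c, hcont, ?_, hunb', ?_⟩
  · refine isPLambdaBV_superposition hpos hB (fun n x y => blockSum_add_two_pi lam α β n x y)
      (fun n x y => ?_)
      (fun n y E => weightedSum_blockSum_le hs0 hαβ.le hpos hanti hmono hα.2.le β n y E)
      (fun n x E => ?_) c
    -- Statements in the second variable follow from those in the first by exchanging `α` and `β`.
    · rw [blockSum_swap, blockSum_add_two_pi, blockSum_swap]
    · simp only [blockSum_swap lam α β n x]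
      exact weightedSum_blockSum_le hs0 hαβ.le hpos hanti hmono hβ.2.le α n x E
  · rintro ⟨L, hL⟩
    obtain ⟨C, hC⟩ := (Metric.isBounded_range_of_tendsto _ hL).exists_norm_le
    exact hunb' ⟨C, fun N => hC _ ⟨N, rfl⟩⟩
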